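/- Let $N$ be a compact oriented 3-manifold whose boundary is a torus, with an ideal triangulation $K$: $K$ is obtained from $n\ge 1$ oriented tetrahedra by gluing their faces in pairs by orientation-reversing maps, $K$ has exactly one 0-simplex, and removing an open neighbourhood of the 0-simplex gives $N$ (so the link of the 0-simplex is a torus). Then $K$ has $n$ one-simplices; number them $e_1,\dots,e_n$. The $\nu$-th tetrahedron has a parameter $z_\nu\in\mathbb{C}\setminus\{0,1\}$; its three pairs of opposite edges carry the parameters $z_\nu$, $\frac{1}{1-z_\nu}$, $1-\frac1{z_\nu}$ (in the cyclic order given by the orientation). Let $p_{i,\nu},p'_{i,\nu},p''_{i,\nu}$ be the numbers of edges of the $\nu$-th tetrahedron attached to $e_i$ with parameter $z_\nu$, $\frac1{1-z_\nu}$, $1-\frac1{z_\nu}$ respectively, let $R_i$ be the product of the parameters of all tetrahedron edges attached to $e_i$, $$R_i=\prod_{\nu=1}^n z_\nu^{p_{i,\nu}}\Big(\frac1{w_\nu}\Big)^{p'_{i,\nu}}\Big(-\frac{w_\nu}{z_\nu}\Big)^{p''_{i,\nu}},\qquad w_\nu=1-z_\nu,$$ and put $r'_{i,\nu}=p_{i,\nu}-p''_{i,\nu}$,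 $r''_{i,\nu}=p''_{i,\nu}-p'_{i,\nu}$. The deformation variety is the affine algebraic set $$\mathcal D(N)=\{(z,w,t)\in\mathbb{C}^{2n+1} : R_1=\dots=R_{n-1}=1,\ z_\nu+w_\nu=1\ (1\le\nu\le n),\ z_1\cdots z_n w_1\cdots w_n t=1\}.$$ An ideal point of $\mathcal D(N)$ is a pair consisting of an irreducible algebraic curve $Y\subset\mathcal D(N)$ and an ideal point of $Y$, that is, a point of the smooth projective model $\tilde Y$ of $Y$ not lying over a point of $Y$; equivalently, a discrete valuation $v$ of $\mathbb{C}(Y)$, trivial on $\mathbb{C}$ and with value group $\mathbb{Z}$, such that $v(f)<0$ for some $f\in\mathbb{C}[Y]$. For $I=(i_1,\dots,i_n)\in\{1,0,\infty\}^n$, the ideal point corresponds to $I$ if $z_\nu\to i_\nu$ there for every $\nu$, that is, $v(w_\nu)>0$ if $i_\nu=1$, $v(z_\nu)>0$ if $i_\nu=0$, and $v(z_\nu)<0$ if $i_\nu=\infty$. Let $R(I)$ be the $(n-1)\times n$ integer matrix whose $(j,\nu)$ entry is $r''_{j,\nu}$ if $i_\nu=1$, $r'_{j,\nu}$ if $i_\nu=0$,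 and $-r'_{j,\nu}-r''_{j,\nu}$ if $i_\nu=\infty$. Let $d(I)_\nu$ be $(-1)^{\nu+1}$ times the determinant of $R(I)$ with its $\nu$-th column removed. **Theorem.** Let $I\in\{1,0,\infty\}^n$. If $d(I)_\nu>0$ for all $\nu$, or $d(I)_\nu<0$ for all $\nu$, then there are ideal points of $\mathcal D(N)$ corresponding to $I$, and their number is exactly $\gcd(d(I)_1,\dots,d(I)_n)$. -/

import Mathlib

noncomputable section

/-! ### Ideal points of an affine algebraic set -/

namespace AffineSet

/-- The coordinate ring `ℂ[Y]` of a subset `Y` of affine space: polynomials modulo those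
vanishing on `Y`. -/
abbrev CoordRing {σ : Type} (Y : Set (σ → ℂ)) : Type :=
  MvPolynomial σ ℂ ⧸ MvPolynomial.vanishingIdeal ℂ Y

/-- The function field `ℂ(Y)`; it is a field when `Y` is irreducible. -/
abbrev FunctionField {σ : Type} (Y : Set (σ → ℂ)) : Type :=
  FractionRing (CoordRing Y)

/-- The `j`-th coordinate function, as an element of `ℂ(Y)`. -/
def coordFun {σ : Type} (Y : Set (σ → ℂ)) (j : σ) : FunctionField Y :=
  algebraMap (CoordRing Y) (FunctionField Y)
    (Ideal.Quotient.mk (MvPolynomial.vanishingIdeal ℂ Y) (MvPolynomial.X j))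

/-- `Y` is an irreducible affine algebraic curve: a Zariski closed irreducible subset of affine
space whose function field has transcendence degree one over `ℂ`. -/
structure IsIrreducibleCurve {σ : Type} (Y : Set (σ → ℂ)) : Prop where
  closed : MvPolynomial.zeroLocus ℂ (MvPolynomial.vanishingIdeal ℂ Y) = Y
  irreducible : (MvPolynomial.vanishingIdeal ℂ Y).IsPrime
  dim_one : Algebra.trdeg ℂ (FunctionField Y) = 1

/-- An ideal point of an affine algebraic set `V`: an irreducible curve `Y` in `V` together with
a point of the smooth projective model of `Y` which does not lie over `Y`.  The points of the
smooth projective model are the normalized discrete valuations `v` of `ℂ(Y)` over `ℂ`; such a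
point lies over a point of `Y` exactly when `v` is nonnegative on `ℂ[Y]`. -/
structure IdealPoint {σ : Type} (V : Set (σ → ℂ)) where
  curve : Set (σ → ℂ)
  curve_subset : curve ⊆ V
  isIrreducibleCurve : IsIrreducibleCurve curve
  val : AddValuation (FunctionField curve) (WithTop ℤ)
  val_const : ∀ c : ℂ, c ≠ 0 → val (algebraMap ℂ (FunctionField curve) c) = 0
  val_normalized : ∃ x : FunctionField curve, val x = 1
  val_ideal : ∃ f : CoordRing curve,
    val (algebraMap (CoordRing curve) (FunctionField curve) f) < 0

end AffineSet

/-! ### Ideal triangulations -/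

/-- A gluing of `n` oriented tetrahedra along their faces.  Each tetrahedron has vertices
`0, 1, 2, 3` in positive order, and its face `f` is the one opposite to the vertex `f`.
The face `f` of the tetrahedron `T` is glued to a face of `adj T f`, the vertex `v ≠ f` of `T`
going to the vertex `glue T f v`, and the face glued to is the one opposite to `glue T f f`.
Gluing maps reverse the orientation of faces, so that the quotient is oriented. -/
structure TetGluing (n : ℕ) where
  adj : Fin n → Fin 4 → Fin n
  glue : Fin n → Fin 4 → Equiv.Perm (Fin 4)
  adj_adj : ∀ T f, adj (adj T f) (glue T f f) = T
  glue_glue : ∀ T f, glue (adj T f) (glue T f f) = (glue T f)⁻¹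
  ne_self : ∀ T f, (adj T f, glue T f f) ≠ (T, f)
  sign_glue : ∀ T f, Equiv.Perm.sign (glue T f) = -1

/-- An edge of a tetrahedron, as a set of two vertices. -/
abbrev TetEdge : Type := {s : Finset (Fin 4) // s.card = 2}

/-- A pair of distinct vertices `(v, u)` of one of `n` tetrahedra. -/
abbrev TetFlag (n : ℕ) : Type := {x : Fin n × Fin 4 × Fin 4 // x.2.1 ≠ x.2.2}

namespace TetGluing

variable {n : ℕ}

/-- Vertices of tetrahedra identified by a face pairing. -/
def VertexRel (K : TetGluing n) (x y : Fin n × Fin 4) : Prop :=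
  ∃ f : Fin 4, f ≠ x.2 ∧ y = (K.adj x.1 f, K.glue x.1 f x.2)

/-- The 0-simplices of the glued complex. -/
def Vertex (K : TetGluing n) : Type := Quot K.VertexRel

/-- Edges of tetrahedra identified by a face pairing. -/
def EdgeRel (K : TetGluing n) (x y : Fin n × TetEdge) : Prop :=
  ∃ f : Fin 4, f ∉ x.2.1 ∧ y.1 = K.adj x.1 f ∧
    y.2.1 = x.2.1.map (K.glue x.1 f).toEmbedding

/-- The 1-simplices of the glued complex. -/
def Edge (K : TetGluing n) : Type := Quot K.EdgeRel

/-- The 1-simplex of the glued complex to which an edge of a tetrahedron is attached. -/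
def edgeClass (K : TetGluing n) (T : Fin n) (s : TetEdge) : K.Edge := Quot.mk K.EdgeRel (T, s)

/-- Truncating the tetrahedron `T` at the vertex `v` gives a triangle; these triangles make up
the link of the 0-simplices (the boundary of a neighbourhood of the 0-skeleton). -/
abbrev LinkTriangle (_K : TetGluing n) : Type := Fin n × Fin 4

/-- The flag `(T, v, u)` is read as the corner, on the tetrahedral edge from `v` to `u`, of the
link triangle at `v`.  It is identified across each face which contains both `v` and `u`. -/
def LinkVertexRel (K : TetGluing n) (x y : TetFlag n) : Prop :=
  ∃ f : Fin 4, f ≠ x.1.2.1 ∧ f ≠ x.1.2.2 ∧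
    y.1 = (K.adj x.1.1 f, K.glue x.1.1 f x.1.2.1, K.glue x.1.1 f x.1.2.2)

/-- The vertices of the link. -/
def LinkVertex (K : TetGluing n) : Type := Quot K.LinkVertexRel

/-- The flag `(T, v, f)` is read as the side, on the face `f`, of the link triangle at `v`.
It is identified with one other side, across the face `f`. -/
def LinkEdgeRel (K : TetGluing n) (x y : TetFlag n) : Prop :=
  y.1 = (K.adj x.1.1 x.1.2.2, K.glue x.1.1 x.1.2.2 x.1.2.1, K.glue x.1.1 x.1.2.2 x.1.2.2)

/-- The edges of the link. -/
def LinkEdge (K : TetGluing n) : Type := Quot K.LinkEdgeRel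

/-- The Euler characteristic of the link. -/
def linkEulerChar (K : TetGluing n) : ℤ :=
  (Nat.card K.LinkVertex : ℤ) - Nat.card K.LinkEdge + Nat.card K.LinkTriangle

end TetGluing

/-- An ideal triangulation, with `n` tetrahedra, of a compact oriented 3-manifold with boundary a
torus: the glued complex has exactly one 0-simplex, and the link of this 0-simplex (a closed
oriented surface, connected since there is one 0-simplex) has Euler characteristic zero. -/
structure IdealTriangulation (n : ℕ) extends TetGluing n where
  one_vertex : Nat.card toTetGluing.Vertex = 1
  torus_link : toTetGluing.linkEulerChar = 0

/-! ### Gluing equations and the deformation variety -/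

/-- The two opposite edges carrying the parameter `z` (by the choice of the labelling of
vertices).  The parameter of the edge `(i, j)` of a tetrahedron with ideal vertices
`x₀, x₁, x₂, x₃` is `(x_k - x_j) (x_l - x_i) / ((x_k - x_i) (x_l - x_j))`, where
`(i, j, k, l)` is an even permutation of `(0, 1, 2, 3)`. -/
def edgesZ : Finset TetEdge := {⟨{0, 1}, by decide⟩, ⟨{2, 3}, by decide⟩}

/-- The two opposite edges carrying the parameter `z' = 1 / (1 - z)`. -/
def edgesZ' : Finset TetEdge := {⟨{0, 3}, by decide⟩, ⟨{1, 2}, by decide⟩}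

/-- The two opposite edges carrying the parameter `z'' = 1 - 1 / z`. -/
def edgesZ'' : Finset TetEdge := {⟨{0, 2}, by decide⟩, ⟨{1, 3}, by decide⟩}

namespace IdealTriangulation

variable {n : ℕ}

/-- The 1-simplices of the triangulation. -/
abbrev Edge (K : IdealTriangulation n) : Type := K.toTetGluing.Edge

open Classical in
/-- The number of edges of the tetrahedron `ν` in the family `A` which are attached to the
1-simplex `e`. -/
def count (K : IdealTriangulation n) (A : Finset TetEdge) (e : K.Edge) (ν : Fin n) : ℕ :=
  (A.filter (fun s => K.edgeClass ν s = e)).card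

/-- The number `p` of edges with parameter `z_ν` attached to `e`. -/
def p (K : IdealTriangulation n) (e : K.Edge) (ν : Fin n) : ℕ := K.count edgesZ e ν

/-- The number `p'` of edges with parameter `1 / (1 - z_ν)` attached to `e`. -/
def p' (K : IdealTriangulation n) (e : K.Edge) (ν : Fin n) : ℕ := K.count edgesZ' e ν

/-- The number `p''` of edges with parameter `1 - 1 / z_ν` attached to `e`. -/
def p'' (K : IdealTriangulation n) (e : K.Edge) (ν : Fin n) : ℕ := K.count edgesZ'' e ν

/-- The exponent `r'` of `z_ν` in the gluing equation at `e`. -/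
def r' (K : IdealTriangulation n) (e : K.Edge) (ν : Fin n) : ℤ := K.p e ν - K.p'' e ν

/-- The exponent `r''` of `w_ν = 1 - z_ν` in the gluing equation at `e`. -/
def r'' (K : IdealTriangulation n) (e : K.Edge) (ν : Fin n) : ℤ := K.p'' e ν - K.p' e ν

/-- The product of the parameters of the edges attached to `e`, where `w_ν = 1 - z_ν`,
`z_ν' = 1 / w_ν` and `z_ν'' = - w_ν / z_ν`. -/
def gluingProduct (K : IdealTriangulation n) (e : K.Edge) (z w : Fin n → ℂ) : ℂ :=
  ∏ ν, z ν ^ K.p e ν * (1 / w ν) ^ K.p' e ν * (-w ν / z ν) ^ K.p'' e ν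

/-- Coordinates `(z_1, …, z_n, w_1, …, w_n, t)` of the affine space containing the deformation
variety. -/
abbrev Coord (n : ℕ) : Type := Fin n ⊕ Fin n ⊕ Unit

/-- The index of the coordinate `z_ν`. -/
abbrev zIdx (ν : Fin n) : Coord n := Sum.inl ν

/-- The index of the coordinate `w_ν`. -/
abbrev wIdx (ν : Fin n) : Coord n := Sum.inr (Sum.inl ν)

/-- The index of the coordinate `t`. -/
abbrev tIdx : Coord n := Sum.inr (Sum.inr ())

/-- The deformation variety as an affine algebraic set in `ℂ ^ (2 n + 1)`, for `n = m + 1`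
tetrahedra and a numbering `E` of the 1-simplices, the last gluing equation being omitted. -/
def deformationVariety {m : ℕ} (K : IdealTriangulation (m + 1)) (E : Fin (m + 1) ≃ K.Edge) :
    Set (Coord (m + 1) → ℂ) :=
  {x | (∀ i : Fin m, K.gluingProduct (E i.castSucc) (fun ν => x (zIdx ν)) (fun ν => x (wIdx ν)) = 1)
    ∧ (∀ ν, x (zIdx ν) + x (wIdx ν) = 1)
    ∧ (∏ ν, x (zIdx ν)) * (∏ ν, x (wIdx ν)) * x tIdx = 1}

end IdealTriangulation

/-! ### Degeneration -/

/-- The possible limits `1`, `0`, `∞` of the parameter of a degenerating tetrahedron. -/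
inductive Degeneration
  | one
  | zero
  | infty

namespace IdealTriangulation

/-- The degeneration matrix `R(I)`, with rows the gluing equations except the last one. -/
def degenerationMatrix {m : ℕ} (K : IdealTriangulation (m + 1)) (E : Fin (m + 1) ≃ K.Edge)
    (I : Fin (m + 1) → Degeneration) : Matrix (Fin m) (Fin (m + 1)) ℤ :=
  Matrix.of fun j ν =>
    match I ν with
    | .one => K.r'' (E j.castSucc) ν
    | .zero => K.r' (E j.castSucc) ν
    | .infty => -K.r' (E j.castSucc) ν - K.r'' (E j.castSucc) ν

/-- The degeneration vector `d(I)`: signed maximal minors of `R(I)`.  Columns are numbered from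
`0`, so the sign at the `ν`-th column is `(-1) ^ ν`. -/
def degenerationVector {m : ℕ} (K : IdealTriangulation (m + 1)) (E : Fin (m + 1) ≃ K.Edge)
    (I : Fin (m + 1) → Degeneration) (ν : Fin (m + 1)) : ℤ :=
  (-1) ^ (ν : ℕ) * ((K.degenerationMatrix E I).submatrix id ν.succAbove).det

end IdealTriangulation

/-- An ideal point corresponds to the degeneration index `I` if, at this point, each `z_ν` tends
to the value `1`, `0` or `∞` prescribed by `I`: the function `w_ν = 1 - z_ν` has a zero,
`z_ν` has a zero, or `z_ν` has a pole there, respectively. -/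
def AffineSet.IdealPoint.CorrespondsTo {n : ℕ} {V : Set (IdealTriangulation.Coord n → ℂ)}
    (P : AffineSet.IdealPoint V) (I : Fin n → Degeneration) : Prop :=
  ∀ ν, match I ν with
    | .one => 0 < P.val (AffineSet.coordFun P.curve (IdealTriangulation.wIdx ν))
    | .zero => 0 < P.val (AffineSet.coordFun P.curve (IdealTriangulation.zIdx ν))
    | .infty => P.val (AffineSet.coordFun P.curve (IdealTriangulation.zIdx ν)) < 0

end

/-! Let `u ν` be whichever of `w ν`, `z ν`, `1 / z ν` vanishes at the degeneration `I`. In these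
coordinates each gluing equation is a monomial in the `u ν` with exponents a row of `R(I)`, times a
monomial in the `1 - u ν`, equated to a sign (`gluing_factor_eq`). At an ideal point the factors `1
- u ν` are congruent to 1, so the values of the `u ν` form a positive vector in the kernel of
`R(I)`. This kernel is the line through `d(I)`, which is why all entries of `d(I)` must have one
sign.

Write `d(I) = ± g a` with `a` primitive and positive, choose `l` with `l · a = 1`, and substitute `τ
= u ^ l`, `u = y τ ^ a`. The system becomes `y ^ B (1 - y τ ^ a) ^ S = ε`, where `B` is `R(I)` with
the row `l` on top, so that `det B = l · d(I) = ± g`. At `τ = 0` there remains the toric system `y ^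
B = ε`, which has `|det B| = g` solutions, the centers (`card_monomialHom_fiber`).

Exactly one branch passes through each center. The local ring there has positive dimension, and
modulo `τ` it is `ℂ` because `y ^ B = ε` has only simple solutions; hence it is a discrete valuation
ring with uniformizer `τ` (`maximalIdeal_eq_span`, `ringKrullDim_ne_zero`). Logarithmic
differentiation shows that its fraction field is algebraic over `ℂ(τ)` (`trdeg_branchField_le`), so
the branch traces a curve, and its valuation gives an ideal point (`exists_idealPoint`).

Conversely, at an ideal point corresponding to `I` the `y ν` are units which reduce to a center, and
the coordinates are the image of the generic point of that branch
(`IsDeformation.exists_branch_hom`). Normalization of the valuation identifies the two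
(`exists_isBranch`), so ideal points and centers are in bijection. -/

noncomputable section

open scoped Matrix

/-! ### Monomial maps between tori -/

section MonomialMap

variable {ι κ μ G H : Type*} [Fintype ι] [CommGroup G] [CommGroup H]

/-- The homomorphism of tori with exponent matrix `B`. -/
def monomialHom (B : Matrix κ ι ℤ) : (ι → G) →* (κ → G) where
  toFun y j := ∏ ν, y ν ^ B j ν
  map_one' := by ext; simp
  map_mul' x y := by ext; simp [mul_zpow, Finset.prod_mul_distrib]

theorem monomialHom_apply (B : Matrix κ ι ℤ) (y : ι → G) (j : κ) :
    monomialHom B y j = ∏ ν, y ν ^ B j ν := rfl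

theorem zpow_finset_sum (y : G) (f : κ → ℤ) (s : Finset κ) :
    y ^ ∑ k ∈ s, f k = ∏ k ∈ s, y ^ f k := by
  classical
  induction s using Finset.induction_on with
  | empty => simp
  | insert k s hk ih => rw [Finset.sum_insert hk, Finset.prod_insert hk, zpow_add, ih]

theorem monomialHom_mul [Fintype κ] (A : Matrix μ κ ℤ) (B : Matrix κ ι ℤ) (y : ι → G) :
    monomialHom (A * B) y = monomialHom A (monomialHom B y) := by
  ext j
  simp only [monomialHom_apply, Matrix.mul_apply, ← Finset.prod_zpow, ← zpow_mul]
  rw [Finset.prod_comm]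
  refine Finset.prod_congr rfl fun ν _ => ?_
  rw [zpow_finset_sum]
  exact Finset.prod_congr rfl fun k _ => by rw [mul_comm]

theorem monomialHom_smul_one [DecidableEq ι] (d : ℤ) (y : ι → G) :
    monomialHom (d • (1 : Matrix ι ι ℤ)) y = y ^ d := by
  ext j
  rw [monomialHom_apply, Finset.prod_eq_single j]
  · simp
  · intro k _ hk
    simp [Matrix.one_apply_ne hk.symm]
  · simp

/-- The identity `adj B * B = det B` on exponents: the monomials of `B` determine `y` up to roots of
unity. -/
theorem pow_det_eq [DecidableEq ι] (B : Matrix ι ι ℤ) (y : ι → G) :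
    y ^ B.det = monomialHom B.adjugate (monomialHom B y) := by
  rw [← monomialHom_mul, Matrix.adjugate_mul, monomialHom_smul_one]

theorem map_monomialHom (f : G →* H) (B : Matrix κ ι ℤ) (y : ι → G) (j : κ) :
    f (monomialHom B y j) = monomialHom B (fun ν => f (y ν)) j := by
  simp [monomialHom_apply]

/-- As `ℂˣ` is divisible, one can take `det B`-th roots of the coordinates and apply the monomial
map of `adj B`. -/
theorem monomialHom_surjective [DecidableEq ι] {B : Matrix ι ι ℤ} (hB : B.det ≠ 0) :
    Function.Surjective (monomialHom (G := ℂˣ) B) := by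
  intro x
  have hroot : ∀ c : ℂˣ, ∃ b : ℂˣ, b ^ B.det = c := by
    have hnat : ∀ c : ℂˣ, ∃ b : ℂˣ, b ^ B.det.natAbs = c := by
      intro c
      have hp : 0 < B.det.natAbs := Int.natAbs_pos.mpr hB
      obtain ⟨b, hb⟩ := IsAlgClosed.exists_pow_nat_eq (c : ℂ) hp
      have hb0 : b ≠ 0 := by
        rintro rfl
        rw [zero_pow hp.ne'] at hb
        exact c.ne_zero hb.symm
      exact ⟨Units.mk0 b hb0, by ext; simpa using hb⟩
    intro c
    rcases Int.natAbs_eq B.det with h | h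
    · obtain ⟨b, hb⟩ := hnat c
      exact ⟨b, by rw [h, zpow_natCast, hb]⟩
    · obtain ⟨b, hb⟩ := hnat c⁻¹
      exact ⟨b, by rw [h, zpow_neg, zpow_natCast, hb, inv_inv]⟩
  choose r hr using fun i => hroot (x i)
  refine ⟨monomialHom B.adjugate r, ?_⟩
  rw [← monomialHom_mul, Matrix.mul_adjugate, monomialHom_smul_one]
  exact funext hr

/-- The lattice spanned by the rows of `B`. -/
def rowLattice [DecidableEq ι] (B : Matrix ι ι ℤ) : Submodule ℤ (ι → ℤ) :=
  LinearMap.range (Matrix.toLin' Bᵀ)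

theorem card_quotient_rowLattice [DecidableEq ι] {B : Matrix ι ι ℤ} (hB : B.det ≠ 0) :
    Nat.card ((ι → ℤ) ⧸ rowLattice B) = B.det.natAbs := by
  have hinj : Function.Injective (Matrix.toLin' Bᵀ) := by
    rw [← LinearMap.ker_eq_bot, LinearMap.ker_eq_bot']
    intro x hx
    rw [Matrix.toLin'_apply] at hx
    exact Matrix.eq_zero_of_mulVec_eq_zero (by rwa [Matrix.det_transpose]) hx
  have h := Submodule.natAbs_det_equiv (rowLattice B) (LinearEquiv.ofInjective _ hinj)
  rw [← h, ← Matrix.det_transpose, ← LinearMap.det_toLin']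
  congr 2

theorem monomialHom_eq_one_of_mem_rowLattice [DecidableEq ι] {B : Matrix ι ι ℤ} {y : ι → G}
    (hy : monomialHom B y = 1) {x : ι → ℤ} (hx : x ∈ rowLattice B) : ∏ ν, y ν ^ x ν = 1 := by
  obtain ⟨t, rfl⟩ := hx
  have h := monomialHom_mul (Matrix.of fun _ : Unit => t) B y
  rw [hy, map_one] at h
  have h' := congrFun h ()
  simp only [monomialHom_apply, Pi.one_apply] at h'
  rw [← h']
  refine Finset.prod_congr rfl fun ν _ => ?_
  simp [Matrix.mul_apply, Matrix.mulVec, dotProduct, mul_comm]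

/-- A point of the kernel is a character of `ℤ^ι` trivial on the rows of `B`, that is, a character
of the quotient by the row lattice. A finite abelian group has as many characters into `ℂˣ` as
elements, and this one has `|det B|`. -/
theorem card_monomialHom_ker [DecidableEq ι] {B : Matrix ι ι ℤ} (hB : B.det ≠ 0) :
    Nat.card (monomialHom (G := ℂˣ) B).ker = B.det.natAbs := by
  let Q := (ι → ℤ) ⧸ rowLattice B
  have hQ : Nat.card Q = B.det.natAbs := card_quotient_rowLattice hB
  have : Finite Q := Nat.finite_of_card_ne_zero (by rw [hQ]; exact Int.natAbs_ne_zero.mpr hB)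
  have hc := CommGroup.card_monoidHom_of_hasEnoughRootsOfUnity (Multiplicative Q) ℂ
  rw [Nat.card_congr (Multiplicative.toAdd (α := Q)), hQ] at hc
  rw [← hc]
  let e (ν : ι) : Multiplicative (ι → ℤ) := Multiplicative.ofAdd (Pi.single ν 1)
  let π : Multiplicative (ι → ℤ) →* Multiplicative Q :=
    AddMonoidHom.toMultiplicative (rowLattice B).mkQ.toAddMonoidHom
  have hπ : ∀ x : ι → ℤ, ∏ ν, e ν ^ x ν = Multiplicative.ofAdd x := by
    intro x
    apply Multiplicative.toAdd.injective
    simp only [toAdd_prod, toAdd_zpow, toAdd_ofAdd, e]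
    ext k
    simp [Finset.sum_apply, Pi.single_apply]
  symm
  refine Nat.card_eq_of_bijective (fun ψ : Multiplicative Q →* ℂˣ =>
    (⟨fun ν => ψ (π (e ν)), ?_⟩ : (monomialHom (G := ℂˣ) B).ker)) ⟨?_, ?_⟩
  · rw [MonoidHom.mem_ker]
    ext j
    have : monomialHom B (fun ν => ψ (π (e ν))) j = (ψ.comp π) (∏ ν, e ν ^ B j ν) := by
      simp [monomialHom_apply]
    rw [this, hπ (B j)]
    have h0 : π (Multiplicative.ofAdd (B j)) = 1 := by
      change Multiplicative.ofAdd ((rowLattice B).mkQ (B j)) = 1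
      rw [ofAdd_eq_one, Submodule.mkQ_apply, Submodule.Quotient.mk_eq_zero]
      refine ⟨Pi.single j 1, ?_⟩
      rw [Matrix.toLin'_apply, Matrix.mulVec_single_one]
      rfl
    simp [h0]
  · intro ψ φ h
    rw [Subtype.mk.injEq] at h
    refine MonoidHom.ext fun q => ?_
    obtain ⟨x, rfl⟩ : ∃ x, π x = q := (rowLattice B).mkQ_surjective q
    have hx : x = ∏ ν, e ν ^ (Multiplicative.toAdd x) ν := (hπ _).symm
    rw [hx]
    simp only [map_prod, map_zpow]
    exact Finset.prod_congr rfl fun ν _ => by rw [congrFun h ν]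
  · rintro ⟨c, hc⟩
    let χ : (ι → ℤ) →+ Additive ℂˣ :=
      { toFun := fun x => Additive.ofMul (∏ ν, c ν ^ x ν)
        map_zero' := by simp
        map_add' := fun x y => by simp [zpow_add, Finset.prod_mul_distrib] }
    have hχ : (rowLattice B).toAddSubgroup ≤ χ.ker := fun x hx =>
      monomialHom_eq_one_of_mem_rowLattice (MonoidHom.mem_ker.mp hc) hx
    let ψ : Q →+ Additive ℂˣ := QuotientAddGroup.lift _ χ hχ
    refine ⟨AddMonoidHom.toMultiplicativeLeft ψ, ?_⟩
    rw [Subtype.mk.injEq]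
    ext ν
    change ((∏ k, c k ^ (Pi.single ν 1 : ι → ℤ) k : ℂˣ) : ℂ) = c ν
    rw [Finset.prod_eq_single ν]
    · simp
    · intro k _ hk
      simp [hk]
    · simp

/-- A nonempty fiber is a coset of the kernel. -/
theorem card_monomialHom_fiber [DecidableEq ι] {B : Matrix ι ι ℤ} (hB : B.det ≠ 0)
    (x : ι → ℂˣ) : Nat.card {c : ι → ℂˣ // monomialHom B c = x} = B.det.natAbs := by
  rw [← card_monomialHom_ker hB]
  obtain ⟨c₀, rfl⟩ := monomialHom_surjective hB x
  refine Nat.card_congr ⟨fun c => ⟨c.1 * c₀⁻¹, ?_⟩, fun k => ⟨k.1 * c₀, ?_⟩, ?_, ?_⟩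
  · rw [MonoidHom.mem_ker, map_mul, map_inv, c.2, mul_inv_cancel]
  · rw [map_mul, MonoidHom.mem_ker.mp k.2, one_mul]
  · intro c; simp
  · intro c; simp

end MonomialMap

/-! ### Local rings -/

/-- In `x ^ n - 1 = (∑ x ^ i) (x - 1)` the sum has residue `n`, hence is a unit in characteristic
zero. -/
theorem IsLocalRing.eq_one_of_pow_eq_one {R : Type*} [CommRing R] [IsLocalRing R] [Algebra ℚ R]
    {x : R} {n : ℕ} (hn : n ≠ 0) (hx : x ^ n = 1) (h : x - 1 ∈ IsLocalRing.maximalIdeal R) :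
    x = 1 := by
  have hmul := Commute.geom_sum₂_mul (Commute.one_right x) n
  rw [one_pow, hx, sub_self] at hmul
  have hu : IsUnit (∑ i ∈ Finset.range n, x ^ i * 1 ^ (n - 1 - i)) := by
    have hx1 : IsLocalRing.residue R x = 1 := by
      rw [← sub_eq_zero, ← map_one (IsLocalRing.residue R), ← map_sub]
      exact Ideal.Quotient.eq_zero_iff_mem.mpr h
    rw [← IsLocalRing.residue_ne_zero_iff_isUnit]
    simp only [map_sum, map_pow, hx1, one_pow, mul_one, Finset.sum_const,
      Finset.card_range, nsmul_eq_mul]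
    have : IsUnit ((n : ℕ) : R) := by
      have := (IsUnit.mk0 (n : ℚ) (by exact_mod_cast hn)).map (algebraMap ℚ R)
      simpa using this
    simpa using (this.map (IsLocalRing.residue R)).ne_zero
  rwa [hu.mul_right_eq_zero, sub_eq_zero] at hmul

/-- Induction on the number of variables: polynomial rings over a field are Jacobson, so a maximal
ideal contracts to a maximal ideal in one variable fewer, and the height drops by exactly one. -/
theorem MvPolynomial.height_of_isMaximal {k σ : Type*} [Field k] [Finite σ]
    (M : Ideal (MvPolynomial σ k)) [hM : M.IsMaximal] : M.height = Nat.card σ := by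
  induction σ using Finite.induction_empty_option with
  | of_equiv e H =>
    rename_i α β
    let φ := (MvPolynomial.renameEquiv k e).toRingEquiv
    have : (M.comap φ).IsMaximal := Ideal.comap_isMaximal_of_equiv φ
    rw [← φ.height_comap, H, Nat.card_congr e]
  | h_empty =>
    have h0 : M.height ≤ ringKrullDim (MvPolynomial PEmpty k) :=
      Ideal.height_le_ringKrullDim_of_ne_top hM.ne_top
    simp only [ringKrullDim_of_isNoetherianRing, ringKrullDim_eq_zero_of_field] at h0
    simp only [Nat.card_of_isEmpty, Nat.cast_zero, zero_add] at h0 ⊢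
    exact le_antisymm (by exact_mod_cast h0) bot_le
  | h_option IH =>
    rename_i α _
    let φ := (MvPolynomial.optionEquivLeft k α).toRingEquiv.symm
    have hP : (M.comap φ).IsMaximal := Ideal.comap_isMaximal_of_equiv φ
    rw [← φ.height_comap]
    set P := M.comap φ
    have hp : (P.comap Polynomial.C).IsMaximal :=
      Polynomial.isMaximal_comap_C_of_isJacobsonRing P
    have : P.LiesOver (P.comap Polynomial.C) := ⟨rfl⟩
    rw [Polynomial.height_eq_height_add_one (P.comap Polynomial.C) P, IH]
    simp [Nat.card_eq_fintype_card]

/-- Positive dimension gives a prime `q` other than the maximal ideal, so `t ∉ q`. An element `b *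
t` of `q` then has `b ∈ q`, so `q` is contained in its product with the maximal ideal, and
Nakayama's lemma gives `q = 0`. -/
theorem IsLocalRing.isDomain_of_maximalIdeal_eq_span {R : Type*} [CommRing R] [IsLocalRing R]
    [IsNoetherianRing R] {t : R} (ht : IsLocalRing.maximalIdeal R = Ideal.span {t})
    (hdim : ringKrullDim R ≠ 0) : IsDomain R ∧ ¬ IsField R := by
  obtain ⟨q, hq, hne⟩ : ∃ q : Ideal R, q.IsPrime ∧ q ≠ IsLocalRing.maximalIdeal R := by
    by_contra! h
    apply hdim
    have hle : ringKrullDim R ≤ 0 := by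
      have : Ring.KrullDimLE 0 R := Ring.krullDimLE_zero_iff.mpr fun I hI => by
        rw [h I hI]; infer_instance
      exact_mod_cast (Ring.krullDimLE_iff (R := R) (n := 0)).mp this
    exact le_antisymm hle ringKrullDim_nonneg_of_nontrivial
  have htq : t ∉ q := by
    intro h
    refine hne (le_antisymm (IsLocalRing.le_maximalIdeal hq.ne_top) ?_)
    rw [ht]
    exact (Ideal.span_singleton_le_iff_mem q).mpr h
  have hbot : q = ⊥ := by
    refine Submodule.eq_bot_of_le_smul_of_le_jacobson_bot (IsLocalRing.maximalIdeal R) q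
      (IsNoetherian.noetherian q) ?_ (IsLocalRing.maximalIdeal_le_jacobson _)
    intro x hx
    have hxm := IsLocalRing.le_maximalIdeal hq.ne_top hx
    rw [ht, Ideal.mem_span_singleton'] at hxm
    obtain ⟨b, rfl⟩ := hxm
    rw [mul_comm, ← smul_eq_mul]
    refine Submodule.smul_mem_smul ?_ ((hq.mem_or_mem hx).resolve_right htq)
    rw [ht]
    exact Ideal.mem_span_singleton_self t
  have : (⊥ : Ideal R).IsPrime := hbot ▸ hq
  refine ⟨IsDomain.of_bot_isPrime R, fun hf => hne ?_⟩
  rw [hbot, IsLocalRing.isField_iff_maximalIdeal_eq.mp hf]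

end

noncomputable section

/-! ### Branches of a perturbed toric system -/

/-- A system of equations `∏ u ^ B * ∏ (1 - u) ^ S = ε` in the unknowns `u = y * τ ^ a`. -/
structure TorusSystem (ι : Type) [Fintype ι] [DecidableEq ι] where
  B : Matrix ι ι ℤ
  S : Matrix ι ι ℤ
  ε : ι → ℂˣ
  a : ι → ℕ
  det_ne : B.det ≠ 0
  a_pos : ∀ ν, 0 < a ν

namespace TorusSystem

variable {ι : Type}

/-- The point `(c, 0)` of affine space with coordinates `y` and `τ`. -/
def centerPoint (c : ι → ℂˣ) : Option ι → ℂ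
  | none => 0
  | some ν => c ν

/-- The coordinates `y` and `τ`, as a point of affine space. -/
def coords {R : Type*} (y : ι → R) (τ : R) : Option ι → R
  | none => τ
  | some ν => y ν

theorem map_aeval_coords {R R' : Type*} [CommRing R] [Algebra ℂ R] [CommRing R'] [Algebra ℂ R']
    (f : R →ₐ[ℂ] R') (y : ι → R) (τ : R) (p : MvPolynomial (Option ι) ℂ) :
    f (MvPolynomial.aeval (coords y τ) p) =
      MvPolynomial.aeval (coords (fun ν => f (y ν)) (f τ)) p := by
  have : f.comp (MvPolynomial.aeval (coords y τ)) =
      MvPolynomial.aeval (coords (fun ν => f (y ν)) (f τ)) := by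
    apply MvPolynomial.algHom_ext
    rintro (_ | ν) <;> simp [coords]
  exact DFunLike.congr_fun this p

section Ambient

variable (c : ι → ℂˣ)

abbrev centerIdeal : Ideal (MvPolynomial (Option ι) ℂ) :=
  RingHom.ker (MvPolynomial.aeval (R := ℂ) (centerPoint c))

instance centerIdeal_isMaximal : (centerIdeal c).IsMaximal :=
  RingHom.ker_isMaximal_of_surjective _ fun z => ⟨MvPolynomial.C z, by simp⟩

/-- The local ring of affine space at `(c, 0)`. -/
abbrev AmbientRing : Type := Localization.AtPrime (centerIdeal c)

theorem AmbientRing.isUnit_algebraMap {g : MvPolynomial (Option ι) ℂ}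
    (hg : MvPolynomial.aeval (centerPoint c) g ≠ 0) : IsUnit (algebraMap _ (AmbientRing c) g) :=
  IsLocalization.map_units (AmbientRing c) (⟨g, hg⟩ : (centerIdeal c).primeCompl)

def ambientY (ν : ι) : (AmbientRing c)ˣ :=
  (AmbientRing.isUnit_algebraMap c (g := MvPolynomial.X (some ν))
    (by simp [centerPoint])).unit

def ambientTau : AmbientRing c := algebraMap _ _ (MvPolynomial.X (R := ℂ) (none : Option ι))

theorem ambient_aeval (p : MvPolynomial (Option ι) ℂ) :
    MvPolynomial.aeval (coords (fun ν => (ambientY c ν : AmbientRing c)) (ambientTau c)) p =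
      algebraMap _ (AmbientRing c) p := by
  have : (MvPolynomial.aeval (coords (fun ν => (ambientY c ν : AmbientRing c)) (ambientTau c))) =
      IsScalarTower.toAlgHom ℂ (MvPolynomial (Option ι) ℂ) (AmbientRing c) := by
    apply MvPolynomial.algHom_ext
    rintro (_ | ν) <;> simp [coords, ambientY, ambientTau]
  rw [this]; rfl

theorem coords_center : coords (fun ν => (c ν : ℂ)) 0 = centerPoint c := by
  ext i; cases i <;> rfl

end Ambient

variable [Fintype ι] [DecidableEq ι] (T : TorusSystem ι)

/-- The solutions of the system at `τ = 0`. -/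
def Center : Type := {c : ι → ℂˣ // monomialHom T.B c = T.ε}

/-- A solution of the system in a `ℂ`-algebra, where `w = 1 - u`. -/
structure IsSolution {R : Type*} [CommRing R] [Algebra ℂ R] (y w : ι → Rˣ) (τ : R) : Prop where
  w_eq : ∀ ν, (w ν : R) = 1 - y ν * τ ^ T.a ν
  eqn : ∀ j, monomialHom T.B y j * monomialHom T.S w j =
    Units.map (algebraMap ℂ R).toMonoidHom (T.ε j)

variable {T} in
theorem IsSolution.map {R R' : Type*} [CommRing R] [Algebra ℂ R] [CommRing R'] [Algebra ℂ R']
    {y w : ι → Rˣ} {τ : R} (h : T.IsSolution y w τ) (f : R →ₐ[ℂ] R') :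
    T.IsSolution (fun ν => Units.map f.toMonoidHom (y ν)) (fun ν => Units.map f.toMonoidHom (w ν))
      (f τ) where
  w_eq ν := by
    change f (w ν : R) = 1 - f (y ν : R) * _
    simp [h.w_eq]
  eqn j := by
    have := congrArg (Units.map f.toMonoidHom) (h.eqn j)
    rw [_root_.map_mul, map_monomialHom, map_monomialHom] at this
    rw [this]
    ext
    exact f.commutes _

/-- The local ring of the branch of solutions through the point `(c, 0)`. -/
structure BranchRing (c : ι → ℂˣ) (A : Type) [CommRing A] [Algebra ℂ A] where
  y : ι → Aˣ
  w : ι → Aˣ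
  τ : A
  isSolution : T.IsSolution y w τ
  -- Elements are fractions in `y` and `τ` with denominator nonvanishing at the center. This makes
  -- the homomorphism in `lift` unique, so existence is all that is required there.
  surj : ∀ x : A, ∃ f g : MvPolynomial (Option ι) ℂ, MvPolynomial.aeval (centerPoint c) g ≠ 0 ∧
    x * MvPolynomial.aeval (coords (fun ν => (y ν : A)) τ) g =
      MvPolynomial.aeval (coords (fun ν => (y ν : A)) τ) f
  lift : ∀ {R : Type} [CommRing R] [Algebra ℂ R] (y' w' : ι → Rˣ) (τ' : R),
    T.IsSolution y' w' τ' →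
    (∀ g : MvPolynomial (Option ι) ℂ, MvPolynomial.aeval (centerPoint c) g ≠ 0 →
      IsUnit (MvPolynomial.aeval (coords (fun ν => (y' ν : R)) τ') g)) →
    ∃ φ : A →ₐ[ℂ] R, φ τ = τ' ∧ ∀ ν, φ (y ν) = y' ν

section Construction

variable (c : ι → ℂˣ)

/-- Since `a ν > 0`, the polynomial `1 - y τ ^ a` has value 1 at `(c, 0)`; its inverse is needed for
negative entries of `S`. -/
def ambientW (ν : ι) : (AmbientRing c)ˣ :=
  (AmbientRing.isUnit_algebraMap c
    (g := 1 - MvPolynomial.X (some ν) * MvPolynomial.X none ^ T.a ν)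
    (by simp [centerPoint, (T.a_pos ν).ne'])).unit

theorem ambient_w_eq (ν : ι) :
    (T.ambientW c ν : AmbientRing c) = 1 - ambientY c ν * ambientTau c ^ T.a ν := by
  simp [ambientW, ambientY, ambientTau]

/-- The `j`-th equation of the system in the local ring at `(c, 0)`. -/
def equation (j : ι) : AmbientRing c :=
  ((monomialHom T.B (ambientY c) j * monomialHom T.S (T.ambientW c) j : (AmbientRing c)ˣ) :
    AmbientRing c) - algebraMap ℂ _ (T.ε j)

/-- The local ring at `(c, 0)` of the scheme of solutions. -/
def SolutionRing : Type := AmbientRing c ⧸ Ideal.span (Set.range (T.equation c))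

instance : CommRing (T.SolutionRing c) :=
  inferInstanceAs (CommRing (AmbientRing c ⧸ Ideal.span (Set.range (T.equation c))))

instance : Algebra ℂ (T.SolutionRing c) :=
  inferInstanceAs (Algebra ℂ (AmbientRing c ⧸ Ideal.span (Set.range (T.equation c))))

/-- The quotient map to the local ring of the scheme of solutions. -/
def toSolutionRing : AmbientRing c →ₐ[ℂ] T.SolutionRing c :=
  Ideal.Quotient.mkₐ ℂ (Ideal.span (Set.range (T.equation c)))

theorem toSolutionRing_surjective : Function.Surjective (T.toSolutionRing c) :=
  Ideal.Quotient.mk_surjective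

theorem ker_toSolutionRing :
    RingHom.ker (T.toSolutionRing c) = Ideal.span (Set.range (T.equation c)) :=
  Ideal.mk_ker

theorem ambient_lift {R : Type} [CommRing R] [Algebra ℂ R] (y' w' : ι → Rˣ) (τ' : R)
    (h : T.IsSolution y' w' τ')
    (hu : ∀ g : MvPolynomial (Option ι) ℂ, MvPolynomial.aeval (centerPoint c) g ≠ 0 →
      IsUnit (MvPolynomial.aeval (coords (fun ν => (y' ν : R)) τ') g)) :
    ∃ φ : AmbientRing c →ₐ[ℂ] R, φ (ambientTau c) = τ' ∧ (∀ ν, φ (ambientY c ν) = y' ν) ∧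
      ∀ j, φ (T.equation c j) = 0 := by
  let φ : AmbientRing c →ₐ[ℂ] R := IsLocalization.liftAlgHom (M := (centerIdeal c).primeCompl)
    (f := MvPolynomial.aeval (coords (fun ν => (y' ν : R)) τ')) fun g => hu g.1 g.2
  have hφ : ∀ p, φ (algebraMap _ _ p) = MvPolynomial.aeval (coords (fun ν => (y' ν : R)) τ') p :=
    fun p => IsLocalization.lift_eq _ p
  have h1 : φ (ambientTau c) = τ' := by
    rw [ambientTau, hφ]; simp [coords]
  have h2 : ∀ ν, φ (ambientY c ν) = y' ν := fun ν => by
    rw [ambientY, IsUnit.unit_spec, hφ]; simp [coords]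
  have h3 : ∀ ν, φ (T.ambientW c ν) = w' ν := fun ν => by
    rw [ambient_w_eq, map_sub, map_mul, map_pow, h1, h2, h.w_eq, map_one]
  refine ⟨φ, h1, h2, fun j => ?_⟩
  have hy : (fun ν => Units.map φ.toMonoidHom (ambientY c ν)) = y' := by
    ext ν; exact h2 ν
  have hw : (fun ν => Units.map φ.toMonoidHom (T.ambientW c ν)) = w' := by
    ext ν; exact h3 ν
  rw [equation, map_sub, sub_eq_zero]
  have := congrArg Units.val (h.eqn j)
  rw [← hy, ← hw, ← map_monomialHom, ← map_monomialHom, ← _root_.map_mul] at this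
  refine Eq.trans this ?_
  exact (φ.commutes _).symm

theorem solution_lift {R : Type} [CommRing R] [Algebra ℂ R] (y' w' : ι → Rˣ) (τ' : R)
    (h : T.IsSolution y' w' τ')
    (hu : ∀ g : MvPolynomial (Option ι) ℂ, MvPolynomial.aeval (centerPoint c) g ≠ 0 →
      IsUnit (MvPolynomial.aeval (coords (fun ν => (y' ν : R)) τ') g)) :
    ∃ φ : T.SolutionRing c →ₐ[ℂ] R, φ (T.toSolutionRing c (ambientTau c)) = τ' ∧
      ∀ ν, φ (T.toSolutionRing c (ambientY c ν)) = y' ν := by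
  obtain ⟨φ, h1, h2, h3⟩ := T.ambient_lift c y' w' τ' h hu
  refine ⟨Ideal.Quotient.liftₐ _ φ ?_, h1, h2⟩
  intro x hx
  refine (Ideal.span_le (I := RingHom.ker φ)).mpr ?_ hx
  rintro _ ⟨j, rfl⟩
  exact h3 j

/-- The tautological solution of the system. -/
def solutionBranch : T.BranchRing c (T.SolutionRing c) where
  y ν := Units.map (T.toSolutionRing c).toMonoidHom (ambientY c ν)
  w ν := Units.map (T.toSolutionRing c).toMonoidHom (T.ambientW c ν)
  τ := T.toSolutionRing c (ambientTau c)
  isSolution :=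
    { w_eq := fun ν => by
        change T.toSolutionRing c (T.ambientW c ν) =
          1 - T.toSolutionRing c (ambientY c ν) * _
        rw [ambient_w_eq, map_sub, map_mul, map_pow, map_one]
      eqn := fun j => by
        rw [← map_monomialHom, ← map_monomialHom, ← _root_.map_mul]
        ext
        have h : T.toSolutionRing c (T.equation c j) = 0 := by
          rw [← RingHom.mem_ker, ker_toSolutionRing]
          exact Ideal.subset_span ⟨j, rfl⟩
        rw [equation, map_sub, sub_eq_zero, AlgHom.commutes] at h
        exact h }
  surj x := by
    obtain ⟨x, rfl⟩ := T.toSolutionRing_surjective c x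
    obtain ⟨⟨f, g⟩, hx⟩ := IsLocalization.surj (centerIdeal c).primeCompl x
    refine ⟨f, g.1, g.2, ?_⟩
    have := congrArg (T.toSolutionRing c) hx
    rw [map_mul, ← ambient_aeval, ← ambient_aeval, map_aeval_coords, map_aeval_coords] at this
    exact this
  lift := T.solution_lift c

end Construction

end TorusSystem

end

/-! ### The local ring at a center is a discrete valuation ring -/

noncomputable section

namespace TorusSystem

open IsLocalRing

variable {ι : Type} [Fintype ι] [DecidableEq ι] {T : TorusSystem ι} (c : T.Center)

theorem isSolution_center : T.IsSolution (R := ℂ) c.1 1 0 where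
  w_eq ν := by simp [(T.a_pos ν).ne']
  eqn j := by
    rw [map_one, c.2]
    simp

theorem exists_evaluation : ∃ φ : T.SolutionRing c.1 →ₐ[ℂ] ℂ,
    φ (T.solutionBranch c.1).τ = 0 ∧ ∀ ν, φ ((T.solutionBranch c.1).y ν) = c.1 ν :=
  (T.solutionBranch c.1).lift c.1 1 0 (isSolution_center c) fun g hg => by
    rw [coords_center]; exact hg.isUnit

/-- Evaluation at the center. -/
def evaluation : T.SolutionRing c.1 →ₐ[ℂ] ℂ := (exists_evaluation c).choose

@[simp]
theorem evaluation_tau : evaluation c (T.solutionBranch c.1).τ = 0 :=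
  (exists_evaluation c).choose_spec.1

@[simp]
theorem evaluation_y (ν : ι) : evaluation c ((T.solutionBranch c.1).y ν) = c.1 ν :=
  (exists_evaluation c).choose_spec.2 ν

theorem evaluation_aeval (p : MvPolynomial (Option ι) ℂ) :
    evaluation c (MvPolynomial.aeval
      (coords (fun ν => ((T.solutionBranch c.1).y ν : T.SolutionRing c.1))
        (T.solutionBranch c.1).τ) p) = MvPolynomial.aeval (centerPoint c.1) p := by
  rw [map_aeval_coords, ← coords_center]
  simp

instance : Nontrivial (T.SolutionRing c.1) := (evaluation c).toRingHom.domain_nontrivial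

instance : IsLocalRing (T.SolutionRing c.1) :=
  IsLocalRing.of_surjective' (T.toSolutionRing c.1).toRingHom (T.toSolutionRing_surjective c.1)

instance : IsNoetherianRing (T.SolutionRing c.1) :=
  isNoetherianRing_of_surjective (AmbientRing c.1) _ (T.toSolutionRing c.1).toRingHom
    (T.toSolutionRing_surjective c.1)

instance : Algebra.EssFiniteType ℂ (AmbientRing c.1) :=
  Algebra.EssFiniteType.comp ℂ (MvPolynomial (Option ι) ℂ) (AmbientRing c.1)

instance : Algebra.EssFiniteType ℂ (T.SolutionRing c.1) :=
  Algebra.EssFiniteType.of_surjective (T.toSolutionRing c.1) (T.toSolutionRing_surjective c.1)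

theorem mem_maximalIdeal_iff (x : T.SolutionRing c.1) :
    x ∈ maximalIdeal (T.SolutionRing c.1) ↔ evaluation c x = 0 := by
  have hsurj : Function.Surjective (evaluation c) := fun z =>
    ⟨algebraMap ℂ _ z, (evaluation c).commutes z⟩
  have hm : (RingHom.ker (evaluation c)).IsMaximal := RingHom.ker_isMaximal_of_surjective _ hsurj
  rw [← IsLocalRing.eq_maximalIdeal hm, RingHom.mem_ker]

theorem isUnit_aeval {g : MvPolynomial (Option ι) ℂ}
    (hg : MvPolynomial.aeval (centerPoint c.1) g ≠ 0) :
    IsUnit (MvPolynomial.aeval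
      (coords (fun ν => ((T.solutionBranch c.1).y ν : T.SolutionRing c.1))
        (T.solutionBranch c.1).τ) g) := by
  rw [← IsLocalRing.notMem_maximalIdeal, mem_maximalIdeal_iff, evaluation_aeval]
  exact hg

/-- Rigidity of the toric system `y ^ B = ε`: the quotient `y / c` is killed by `B`, hence by the
power `|det B|`, and a root of unity congruent to 1 modulo the maximal ideal equals 1. -/
theorem eq_center_of_tau_eq_zero {R : Type*} [CommRing R] [IsLocalRing R] [Algebra ℂ R]
    {y w : ι → Rˣ} (h : T.IsSolution y w 0)
    (hy : ∀ ν, (y ν : R) - algebraMap ℂ R (c.1 ν) ∈ maximalIdeal R) (ν : ι) :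
    (y ν : R) = algebraMap ℂ R (c.1 ν) := by
  let _ : Algebra ℚ R := ((algebraMap ℂ R).comp (algebraMap ℚ ℂ)).toAlgebra
  let d : ι → Rˣ := fun ν => Units.map (algebraMap ℂ R).toMonoidHom (c.1 ν)
  have hw : w = 1 := by
    ext ν
    rw [h.w_eq, zero_pow (T.a_pos ν).ne', mul_zero, sub_zero]
    rfl
  have hB : monomialHom T.B (y * d⁻¹) = 1 := by
    rw [_root_.map_mul, _root_.map_inv, mul_inv_eq_one]
    ext j
    have h1 := h.eqn j
    rw [hw, map_one, Pi.one_apply, mul_one, ← c.2, map_monomialHom] at h1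
    rw [h1]
  have hdet := pow_det_eq T.B (y * d⁻¹)
  rw [hB, map_one] at hdet
  have hdet' : (y ν * (d ν)⁻¹) ^ T.B.det.natAbs = 1 := by
    have := congrFun hdet ν
    exact pow_natAbs_eq_one.mpr this
  have hone : ((y ν * (d ν)⁻¹ : Rˣ) : R) = 1 := by
    refine IsLocalRing.eq_one_of_pow_eq_one (Int.natAbs_ne_zero.mpr T.det_ne) ?_ ?_
    · rw [← Units.val_pow_eq_pow_val, hdet', Units.val_one]
    · have : ((y ν * (d ν)⁻¹ : Rˣ) : R) - 1 = ((y ν : R) - d ν) * ((d ν)⁻¹ : Rˣ) := by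
        rw [sub_mul, Units.mul_inv, Units.val_mul]
      rw [this]
      exact Ideal.mul_mem_right _ _ (hy ν)
  rw [Units.val_eq_one, mul_inv_eq_one] at hone
  rw [hone]
  rfl

/-- Modulo `τ` the tautological solution is the constant point `c` by rigidity. So every fraction in
`y` and `τ` becomes its value at the center, and one vanishing there is divisible by `τ`. -/
theorem maximalIdeal_eq_span :
    maximalIdeal (T.SolutionRing c.1) = Ideal.span {(T.solutionBranch c.1).τ} := by
  set b := T.solutionBranch c.1
  set J := Ideal.span {b.τ}
  have hJ : J ≤ maximalIdeal (T.SolutionRing c.1) := by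
    rw [Ideal.span_singleton_le_iff_mem, mem_maximalIdeal_iff]
    exact evaluation_tau c
  refine le_antisymm (fun x hx => ?_) hJ
  have : Nontrivial (T.SolutionRing c.1 ⧸ J) := Ideal.Quotient.nontrivial_iff.mpr fun h =>
    (maximalIdeal.isMaximal (T.SolutionRing c.1)).ne_top (top_le_iff.mp (h ▸ hJ))
  have : IsLocalRing (T.SolutionRing c.1 ⧸ J) :=
    IsLocalRing.of_surjective' (Ideal.Quotient.mk J) Ideal.Quotient.mk_surjective
  let π : T.SolutionRing c.1 →ₐ[ℂ] T.SolutionRing c.1 ⧸ J := Ideal.Quotient.mkₐ ℂ J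
  have hτ : π b.τ = 0 := Ideal.Quotient.eq_zero_iff_mem.mpr (Ideal.mem_span_singleton_self _)
  have hloc : IsLocalHom π.toRingHom :=
    IsLocalHom.of_surjective π.toRingHom Ideal.Quotient.mk_surjective
  have hsol := b.isSolution.map π
  rw [hτ] at hsol
  have hy : ∀ ν, π (b.y ν) = algebraMap ℂ _ ((c.1 ν : ℂˣ) : ℂ) := by
    refine eq_center_of_tau_eq_zero c hsol fun ν => ?_
    have h1 : (b.y ν : T.SolutionRing c.1) - algebraMap ℂ _ ((c.1 ν : ℂˣ) : ℂ) ∈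
        maximalIdeal (T.SolutionRing c.1) := by
      rw [mem_maximalIdeal_iff, map_sub, AlgHom.commutes, evaluation_y]
      exact sub_self _
    have h2 := ((local_hom_TFAE π.toRingHom).out 0 4).mp hloc
    have h3 : _ ∈ (maximalIdeal (T.SolutionRing c.1 ⧸ J)).comap π.toRingHom := h2 ▸ h1
    rw [Ideal.mem_comap] at h3
    have h4 : π.toRingHom ((b.y ν : T.SolutionRing c.1) - algebraMap ℂ _ ((c.1 ν : ℂˣ) : ℂ)) =
      π (b.y ν) - algebraMap ℂ _ ((c.1 ν : ℂˣ) : ℂ) := by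
      change π _ = _
      rw [map_sub, AlgHom.commutes]
    rw [h4] at h3
    exact h3
  obtain ⟨f, g, hg, hfg⟩ := b.surj x
  have hf : MvPolynomial.aeval (centerPoint c.1) f = 0 := by
    rw [← evaluation_aeval c f, ← hfg, map_mul, (mem_maximalIdeal_iff c x).mp hx, zero_mul]
  have hpi : ∀ p : MvPolynomial (Option ι) ℂ,
      π (MvPolynomial.aeval (coords (fun ν => (b.y ν : T.SolutionRing c.1)) b.τ) p) =
      algebraMap ℂ _ (MvPolynomial.aeval (centerPoint c.1) p) := by
    intro p
    rw [map_aeval_coords, ← coords_center, hτ]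
    have := map_aeval_coords (R := ℂ) (Algebra.ofId ℂ (T.SolutionRing c.1 ⧸ J))
      (fun ν => (c.1 ν : ℂ)) 0 p
    rw [Algebra.ofId_apply, map_zero] at this
    rw [this]
    simp only [Algebra.ofId_apply, hy]
  have h0 := congrArg π hfg
  rw [map_mul, hpi, hpi, hf, map_zero] at h0
  have hu : IsUnit (algebraMap ℂ (T.SolutionRing c.1 ⧸ J)
    (MvPolynomial.aeval (centerPoint c.1) g)) := hg.isUnit.map _
  rw [hu.mul_left_eq_zero] at h0
  exact Ideal.Quotient.eq_zero_iff_mem.mp h0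

/-- The ambient local ring has dimension `|ι| + 1`, and each of the `|ι|` equations, which vanish at
the center, lowers the dimension by at most one. -/
theorem ringKrullDim_ne_zero : ringKrullDim (T.SolutionRing c.1) ≠ 0 := by
  intro h0
  have hs : Set.range (T.equation c.1) ⊆ Ring.jacobson (AmbientRing c.1) := by
    rintro _ ⟨j, rfl⟩
    rw [SetLike.mem_coe, IsLocalRing.ringJacobson_eq_maximalIdeal]
    obtain ⟨φ, -, -, h⟩ := T.ambient_lift c.1 c.1 1 0 (isSolution_center c) fun g hg => by
      rw [coords_center]; exact hg.isUnit
    exact le_maximalIdeal (RingHom.ker_ne_top φ) (h j)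
  have h1 := ringKrullDim_le_ringKrullDim_quotient_add_encard _ hs
  have h2 : ringKrullDim (AmbientRing c.1 ⧸ Ideal.span (Set.range (T.equation c.1))) = 0 := h0
  rw [h2, zero_add, IsLocalization.AtPrime.ringKrullDim_eq_height (centerIdeal c.1),
    MvPolynomial.height_of_isMaximal] at h1
  have h3 : (Set.range (T.equation c.1)).encard ≤ (Fintype.card ι : ℕ∞) := by
    rw [← Set.image_univ]
    refine (Set.encard_image_le _ _).trans ?_
    rw [Set.encard_univ, ENat.card_eq_coe_fintype_card]
  have h4 : ((Nat.card (Option ι) : ℕ∞) : WithBot ℕ∞) ≤ ((Fintype.card ι : ℕ∞) : WithBot ℕ∞) :=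
    h1.trans (WithBot.coe_le_coe.mpr h3)
  rw [Nat.card_eq_fintype_card, Fintype.card_option, WithBot.coe_le_coe] at h4
  have h5 : Fintype.card ι + 1 ≤ Fintype.card ι := by exact_mod_cast h4
  omega

instance : IsDomain (T.SolutionRing c.1) :=
  (IsLocalRing.isDomain_of_maximalIdeal_eq_span (maximalIdeal_eq_span c)
    (ringKrullDim_ne_zero c)).1

instance : IsDiscreteValuationRing (T.SolutionRing c.1) := by
  have h := IsDiscreteValuationRing.TFAE _ (IsLocalRing.isDomain_of_maximalIdeal_eq_span
    (maximalIdeal_eq_span c) (ringKrullDim_ne_zero c)).2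
  have h' : (maximalIdeal (T.SolutionRing c.1)).IsPrincipal := ⟨_, maximalIdeal_eq_span c⟩
  exact (h.out 0 4).mpr h'

theorem irreducible_tau : Irreducible (T.solutionBranch c.1).τ :=
  (IsDiscreteValuationRing.irreducible_iff_uniformizer _).mpr (maximalIdeal_eq_span c)

end TorusSystem

end

noncomputable section

/-! ### Logarithmic derivatives -/

namespace Derivation

variable {R K M : Type*} [CommRing R] [Field K] [Algebra R K] [AddCommGroup M] [Module K M]
  [Module R M]

/-- The logarithmic derivative `x⁻¹ D x`, as a homomorphism. -/
def logDeriv (D : Derivation R K M) : Kˣ →* Multiplicative M where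
  toFun x := Multiplicative.ofAdd ((x : K)⁻¹ • D x)
  map_one' := by simp
  map_mul' x y := by
    rw [← ofAdd_add]
    congr 1
    have hx := x.ne_zero
    have hy := y.ne_zero
    rw [Units.val_mul, leibniz, smul_add, smul_smul, smul_smul, add_comm]
    congr 2 <;> field_simp

theorem toAdd_logDeriv (D : Derivation R K M) (x : Kˣ) :
    Multiplicative.toAdd (D.logDeriv x) = (x : K)⁻¹ • D x := rfl

theorem toAdd_logDeriv_monomialHom {ι κ : Type*} [Fintype ι] (D : Derivation R K M)
    (B : Matrix κ ι ℤ) (y : ι → Kˣ) (j : κ) :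
    Multiplicative.toAdd (D.logDeriv (monomialHom B y j)) =
      ∑ ν, (B j ν : K) • (y ν : K)⁻¹ • D (y ν) := by
  rw [map_monomialHom, monomialHom_apply]
  simp [toAdd_logDeriv, Int.cast_smul_eq_zsmul]

end Derivation

/-- Multiplication by the adjugate. The unknowns are vectors because they will be differentials. -/
theorem Matrix.eq_zero_of_sum_smul_eq_zero {ι K M : Type*} [Fintype ι] [DecidableEq ι] [Field K]
    [AddCommGroup M] [Module K M] {N : Matrix ι ι K} (hN : N.det ≠ 0) {x : ι → M}
    (h : ∀ j, ∑ ν, N j ν • x ν = 0) (k : ι) : x k = 0 := by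
  have h1 : ∑ j, N.adjugate k j • ∑ ν, N j ν • x ν = N.det • x k := by
    simp only [Finset.smul_sum, smul_smul]
    rw [Finset.sum_comm]
    simp only [← Finset.sum_smul, ← Matrix.mul_apply, Matrix.adjugate_mul]
    rw [Finset.sum_eq_single k]
    · simp
    · intro i _ hi
      simp [Matrix.one_apply_ne hi.symm]
    · simp
  simp only [h, smul_zero, Finset.sum_const_zero] at h1
  exact (smul_eq_zero.mp h1.symm).resolve_left hN

/-! ### The valuation of a discrete valuation ring on its fraction field -/

/-- The order function with values in `ℕ∞` is pushed to `WithTop ℤ`, where it extends to fractions;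
only the two properties used later are kept. -/
theorem IsDiscreteValuationRing.exists_addValuation (A K : Type*) [CommRing A] [IsDomain A]
    [IsDiscreteValuationRing A] [Field K] [Algebra A K] [IsFractionRing A K] :
    ∃ v : AddValuation K (WithTop ℤ), (∀ a : A, 0 ≤ v (algebraMap A K a)) ∧
      ∀ ϖ : A, Irreducible ϖ → v (algebraMap A K ϖ) = 1 := by
  let f : ℕ∞ →+ WithTop ℤ := AddMonoidHom.withTopMap (Nat.castAddMonoidHom ℤ)
  have hf : ∀ n : ℕ, f n = ((n : ℤ) : WithTop ℤ) := fun n => rfl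
  have hft : f ⊤ = ⊤ := rfl
  have hmono : Monotone f := by
    intro a b hab
    induction b using ENat.recTopCoe with
    | top => rw [hft]; exact le_top
    | coe b =>
      induction a using ENat.recTopCoe with
      | top => simp at hab
      | coe a =>
        rw [hf, hf, WithTop.coe_le_coe]
        exact_mod_cast hab
  let v₀ : AddValuation A (WithTop ℤ) := (addVal A).map f hft hmono
  have hv₀ : ∀ a, v₀ a = f (addVal A a) := fun a => rfl
  have hS : nonZeroDivisors A ≤ (AddValuation.toValuation v₀).supp.primeCompl := by
    intro a ha h
    have h1 : v₀ a = ⊤ := (AddValuation.mem_supp_iff v₀ a).mp h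
    rw [hv₀] at h1
    have h2 : addVal A a ≠ ⊤ := by
      rw [ne_eq, addVal_eq_top_iff]
      exact nonZeroDivisors.ne_zero ha
    obtain ⟨n, hn⟩ := ENat.ne_top_iff_exists.mp h2
    rw [← hn, hf] at h1
    exact WithTop.coe_ne_top h1
  let v : AddValuation K (WithTop ℤ) :=
    AddValuation.ofValuation ((AddValuation.toValuation v₀).extendToLocalization hS K)
  have hv : ∀ a, v (algebraMap A K a) = f (addVal A a) := fun a =>
    Valuation.extendToLocalization_apply_map_apply _ hS K a
  refine ⟨v, fun a => ?_, fun ϖ hϖ => ?_⟩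
  · rw [hv, ← map_zero f]
    exact hmono bot_le
  · rw [hv, addVal_uniformizer hϖ]
    exact hf 1

theorem AddValuation.map_unit_eq_zero {A K : Type*} [CommRing A] [Field K] [Algebra A K]
    (v : AddValuation K (WithTop ℤ)) (h : ∀ a : A, 0 ≤ v (algebraMap A K a)) (u : Aˣ) :
    v (algebraMap A K u) = 0 := by
  refine le_antisymm ?_ (h u)
  have h1 : v (algebraMap A K u) + v (algebraMap A K (u⁻¹ : Aˣ)) = 0 := by
    rw [← v.map_mul, ← _root_.map_mul, Units.mul_inv, _root_.map_one, v.map_one]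
  calc v (algebraMap A K u) ≤ v (algebraMap A K u) + v (algebraMap A K (u⁻¹ : Aˣ)) :=
        le_add_of_nonneg_right (h _)
    _ = 0 := h1

/-! ### The function field of a branch -/

namespace TorusSystem

open IsLocalRing

variable {ι : Type} [Fintype ι] [DecidableEq ι] {T : TorusSystem ι} (c : T.Center)

/-- The function field of a branch. -/
abbrev BranchField : Type := FractionRing (T.SolutionRing c.1)

/-- The canonical map to the function field of a branch. -/
abbrev toBranchField : T.SolutionRing c.1 →ₐ[ℂ] BranchField c :=
  IsScalarTower.toAlgHom ℂ (T.SolutionRing c.1) (BranchField c)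

theorem toBranchField_injective : Function.Injective (toBranchField c) :=
  IsFractionRing.injective (T.SolutionRing c.1) (BranchField c)

/-- The matrix of the logarithmic differential of the system. -/
def logJacobian (j ν : ι) : T.SolutionRing c.1 :=
  (T.B j ν : T.SolutionRing c.1) -
    (T.S j ν : T.SolutionRing c.1) * (((T.solutionBranch c.1).w ν)⁻¹ : (T.SolutionRing c.1)ˣ) *
      ((T.solutionBranch c.1).y ν * (T.solutionBranch c.1).τ ^ T.a ν)

/-- At the center `τ = 0`, so the matrix specializes to `B`, whose determinant is nonzero. -/
theorem det_logJacobian_ne_zero :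
    ((toBranchField c).toRingHom.mapMatrix (Matrix.of (logJacobian c))).det ≠ 0 := by
  rw [← RingHom.map_det]
  refine (map_ne_zero_iff (toBranchField c).toRingHom (toBranchField_injective c)).mpr fun h => ?_
  have h1 := congrArg (evaluation c).toRingHom h
  rw [RingHom.map_det, _root_.map_zero] at h1
  have h2 : (evaluation c).toRingHom.mapMatrix (Matrix.of (logJacobian c)) =
      (Int.castRingHom ℂ).mapMatrix T.B := by
    ext j ν
    change evaluation c (logJacobian c j ν) = _
    simp [logJacobian, (T.a_pos ν).ne']
  rw [h2, ← RingHom.map_det] at h1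
  exact T.det_ne (by simpa using h1)

/-- If `D τ = 0` then `D w = -τ ^ a D y`, and the logarithmic derivatives of the equations form a
linear system for the `y⁻¹ D y` with matrix `logJacobian`. It is nonsingular, so `D` kills every `y
ν`, hence all fractions in `y` and `τ`. -/
theorem derivation_eq_zero {M : Type*} [AddCommGroup M] [Module (BranchField c) M] [Module ℂ M]
    [IsScalarTower ℂ (BranchField c) M]
    (D : Derivation ℂ (BranchField c) M)
    (hτ : D (toBranchField c (T.solutionBranch c.1).τ) = 0) (x : BranchField c) : D x = 0 := by
  set b := T.solutionBranch c.1
  set φ := toBranchField c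
  have hsol := b.isSolution.map φ
  set y := fun ν => Units.map φ.toMonoidHom (b.y ν) with hy
  set w := fun ν => Units.map φ.toMonoidHom (b.w ν) with hw
  have hDw : ∀ ν, D (w ν : BranchField c) = -((φ b.τ) ^ T.a ν • D (y ν : BranchField c)) := by
    intro ν
    rw [hsol.w_eq, _root_.map_sub, D.leibniz, D.leibniz_pow, hτ]
    simp
  have hDy : ∀ ν, ((y ν : BranchField c)⁻¹ • D (y ν : BranchField c)) = 0 := by
    refine Matrix.eq_zero_of_sum_smul_eq_zero (det_logJacobian_ne_zero c) fun j => ?_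
    have h1 := congrArg (fun x => Multiplicative.toAdd (D.logDeriv x)) (hsol.eqn j)
    simp only [_root_.map_mul, toAdd_mul, Derivation.toAdd_logDeriv_monomialHom] at h1
    rw [Derivation.toAdd_logDeriv] at h1
    have h2 : D ((Units.map (algebraMap ℂ (BranchField c)).toMonoidHom (T.ε j) :
        (BranchField c)ˣ) : BranchField c) = 0 := D.map_algebraMap _
    rw [h2, smul_zero, ← Finset.sum_add_distrib] at h1
    rw [← h1]
    refine Finset.sum_congr rfl fun ν _ => ?_
    rw [hDw]
    have hyν : (y ν : BranchField c) ≠ 0 := (y ν).ne_zero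
    have hwinv : φ (((b.w ν)⁻¹ : (T.SolutionRing c.1)ˣ) : T.SolutionRing c.1) =
        (w ν : BranchField c)⁻¹ := by
      rw [← Units.val_inv_eq_inv_val, hw]
      rfl
    have hentry : (φ.toRingHom.mapMatrix (Matrix.of (logJacobian c))) j ν =
        (T.B j ν : BranchField c) - (T.S j ν : BranchField c) * (w ν : BranchField c)⁻¹ *
          (y ν * φ b.τ ^ T.a ν) := by
      change φ (logJacobian c j ν) = _
      rw [logJacobian, _root_.map_sub, _root_.map_mul, _root_.map_mul, _root_.map_mul,
        _root_.map_pow, hwinv, map_intCast, map_intCast]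
      rfl
    rw [hentry, sub_smul, sub_eq_add_neg]
    congr 1
    rw [smul_neg, smul_neg, smul_smul, smul_smul, smul_smul]
    congr 2
    field_simp
  have hDy' : ∀ ν, D (φ (b.y ν)) = 0 := fun ν =>
    (smul_eq_zero.mp (hDy ν)).resolve_left (inv_ne_zero (y ν).ne_zero)
  have hp : ∀ p : MvPolynomial (Option ι) ℂ, D (φ (MvPolynomial.aeval
      (coords (fun ν => (b.y ν : T.SolutionRing c.1)) b.τ) p)) = 0 := by
    intro p
    rw [map_aeval_coords]
    induction p using MvPolynomial.induction_on with
    | C z => rw [MvPolynomial.aeval_C, D.map_algebraMap]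
    | add p q hp hq => rw [_root_.map_add, _root_.map_add, hp, hq, add_zero]
    | mul_X p i hp =>
      rw [_root_.map_mul, D.leibniz, hp, MvPolynomial.aeval_X]
      cases i with
      | none => simp [coords, hτ]
      | some ν => simp [coords, hDy']
  have hA : ∀ a : T.SolutionRing c.1, D (φ a) = 0 := by
    intro a
    obtain ⟨f, g, hg, hfg⟩ := b.surj a
    have h1 := congrArg D (congrArg φ hfg)
    rw [_root_.map_mul, D.leibniz, hp, hp, smul_zero, zero_add] at h1
    refine (smul_eq_zero.mp h1).resolve_left ?_
    exact (map_ne_zero_iff φ (toBranchField_injective c)).mpr (isUnit_aeval c hg).ne_zero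
  obtain ⟨a, d, hd, rfl⟩ := IsFractionRing.div_surjective (A := T.SolutionRing c.1) x
  have h1 : D (φ a / φ d) = 0 := by
    rw [D.leibniz_div, hA, hA]
    simp
  exact h1

/-- By `derivation_eq_zero` the field has no differentials over `ℂ(τ)`. Being essentially of finite
type, it is then separable algebraic over `ℂ(τ)`. -/
theorem trdeg_branchField_le : Algebra.trdeg ℂ (BranchField c) ≤ 1 := by
  open scoped IntermediateField.algebraAdjoinAdjoin in
  set t := toBranchField c (T.solutionBranch c.1).τ with ht
  let K := IntermediateField.adjoin ℂ {t}
  have htK : t ∈ K := IntermediateField.mem_adjoin_simple_self ℂ t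
  have hD : ∀ x, KaehlerDifferential.D K (BranchField c) x = 0 := by
    intro x
    have := derivation_eq_zero c
      ((KaehlerDifferential.D K (BranchField c)).restrictScalars ℂ) ?_ x
    · exact this
    · exact (KaehlerDifferential.D K (BranchField c)).map_algebraMap (⟨t, htK⟩ : K)
  have hsub : Subsingleton (Ω[BranchField c⁄K]) := by
    rw [← Submodule.subsingleton_iff (BranchField c), ← subsingleton_iff_bot_eq_top,
      ← KaehlerDifferential.span_range_derivation, eq_comm, Submodule.span_eq_bot]
    rintro _ ⟨x, rfl⟩
    exact hD x
  have hunr : Algebra.FormallyUnramified K (BranchField c) := ⟨hsub⟩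
  have hess : Algebra.EssFiniteType K (BranchField c) :=
    Algebra.EssFiniteType.of_comp ℂ K (BranchField c)
  have hsep := Algebra.FormallyUnramified.isSeparable K (BranchField c)
  have halg : Algebra.IsAlgebraic K (BranchField c) := inferInstance
  have halg' : Algebra.IsAlgebraic (Algebra.adjoin ℂ {t}) (BranchField c) :=
    (IsFractionRing.comap_isAlgebraic_iff (K := K)).mpr halg
  have := Algebra.IsAlgebraic.trdeg_le_cardinalMk (R := ℂ) (s := ({t} : Set (BranchField c)))
  simpa using this

end TorusSystem

end

noncomputable section

/-! ### Valuations trivial on the constants -/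

namespace AddValuation

variable {F : Type*} [Field F] (v : AddValuation F (WithTop ℤ))

theorem const_nonneg [Algebra ℂ F] (hv : ∀ z : ℂ, z ≠ 0 → v (algebraMap ℂ F z) = 0) (z : ℂ) :
    0 ≤ v (algebraMap ℂ F z) := by
  by_cases hz : z = 0
  · simp [hz]
  · rw [hv z hz]

theorem exists_pos_of_prod_pos {s : Multiset F} (h : 0 < v s.prod) : ∃ x ∈ s, 0 < v x := by
  induction s using Multiset.induction_on with
  | empty => simp at h
  | cons x s ih =>
    by_cases hx : 0 < v x
    · exact ⟨x, Multiset.mem_cons_self x s, hx⟩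
    · rw [Multiset.prod_cons, v.map_mul] at h
      have hs : 0 < v s.prod := by
        by_contra hs
        exact absurd h (not_lt.mpr (add_nonpos (not_lt.mp hx) (not_lt.mp hs)))
      obtain ⟨y, hy, hy'⟩ := ih hs
      exact ⟨y, Multiset.mem_cons_of_mem hy, hy'⟩

theorem nonneg_of_sub_pos {x y : F} (hy : 0 ≤ v y) (h : 0 < v (x - y)) : 0 ≤ v x := by
  have := v.map_le_add h.le hy
  rwa [sub_add_cancel] at this

/-- The units congruent to one modulo the maximal ideal. -/
def principalUnits : Subgroup Fˣ where
  carrier := {x | 0 < v ((x : F) - 1)}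
  one_mem' := by simp
  mul_mem' {x y} hx hy := by
    change 0 < v (((x * y : Fˣ) : F) - 1)
    have : ((x * y : Fˣ) : F) - 1 = x * (y - 1) + (x - 1) := by rw [Units.val_mul]; ring
    rw [this]
    refine v.map_lt_add ?_ hx
    rw [v.map_mul]
    exact hy.trans_le (le_add_of_nonneg_left (v.nonneg_of_sub_pos (by simp) hx))
  inv_mem' {x} hx := by
    change 0 < v (((x⁻¹ : Fˣ) : F) - 1)
    have h0 : v (x : F) = 0 := by
      rw [v.map_eq_of_lt_sub (x := (1 : F)) (by rw [v.map_one]; exact hx), v.map_one]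
    have : ((x⁻¹ : Fˣ) : F) - 1 = -((x : F)⁻¹ * (x - 1)) := by
      rw [Units.val_inv_eq_inv_val, mul_sub, inv_mul_cancel₀ x.ne_zero]; ring
    rw [this, v.map_neg, v.map_mul, v.map_inv, h0]
    simpa using hx

theorem mem_principalUnits {x : Fˣ} : x ∈ v.principalUnits ↔ 0 < v ((x : F) - 1) := Iff.rfl

theorem monomialHom_mem_principalUnits {ι κ : Type*} [Fintype ι] (B : Matrix κ ι ℤ) {y : ι → Fˣ}
    (hy : ∀ ν, y ν ∈ v.principalUnits) (j : κ) : monomialHom B y j ∈ v.principalUnits :=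
  Subgroup.prod_mem _ fun ν _ => Subgroup.zpow_mem _ (hy ν) _

variable [Algebra ℂ F] {v} (hv : ∀ z : ℂ, z ≠ 0 → v (algebraMap ℂ F z) = 0)
include hv

/-- Over `ℂ` the element `x ^ n - b` is a product of factors `x - r`. Its value is positive, so some
factor has positive value. No assumption on the residue field of `v` is needed. -/
theorem exists_const_of_pow_mem {x : Fˣ} {b : ℂˣ} {n : ℕ} (hn : n ≠ 0)
    (h : x ^ n * (Units.map (algebraMap ℂ F).toMonoidHom b)⁻¹ ∈ v.principalUnits) :
    ∃ r : ℂˣ, x * (Units.map (algebraMap ℂ F).toMonoidHom r)⁻¹ ∈ v.principalUnits := by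
  have key : ∀ (x : Fˣ) (r : ℂˣ), v ((x : F) - algebraMap ℂ F r) =
      v (((x * (Units.map (algebraMap ℂ F).toMonoidHom r)⁻¹ : Fˣ) : F) - 1) := by
    intro x r
    have hr : algebraMap ℂ F r ≠ 0 :=
      (map_ne_zero_iff _ (algebraMap ℂ F).injective).mpr r.ne_zero
    have : (x : F) - algebraMap ℂ F r =
        (((x * (Units.map (algebraMap ℂ F).toMonoidHom r)⁻¹ : Fˣ) : F) - 1) *
          algebraMap ℂ F r := by
      rw [Units.val_mul, Units.val_inv_eq_inv_val]
      change _ = ((x : F) * (algebraMap ℂ F r)⁻¹ - 1) * algebraMap ℂ F r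
      field_simp
    rw [this, v.map_mul, hv _ r.ne_zero, add_zero]
  rw [mem_principalUnits, ← key, Units.val_pow_eq_pow_val] at h
  let p : Polynomial ℂ := Polynomial.X ^ n - Polynomial.C (b : ℂ)
  have hmonic : p.Monic := Polynomial.monic_X_pow_sub_C _ hn
  have hp : (p.roots.map fun r => (x : F) - algebraMap ℂ F r).prod =
      (x : F) ^ n - algebraMap ℂ F b := by
    have h1 := (IsAlgClosed.splits p).eq_prod_roots_of_monic hmonic
    have h2 := congrArg (Polynomial.aeval (x : F)) h1
    rw [map_multiset_prod, Multiset.map_map] at h2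
    have h3 : Polynomial.aeval (x : F) p = (x : F) ^ n - algebraMap ℂ F b := by simp [p]
    rw [← h3, h2]
    congr 1
    exact Multiset.map_congr rfl fun r _ => by simp
  rw [← hp] at h
  obtain ⟨_, hmem, hpos⟩ := v.exists_pos_of_prod_pos h
  obtain ⟨r, hr, rfl⟩ := Multiset.mem_map.mp hmem
  have hr0 : r ≠ 0 := by
    rintro rfl
    have := (Polynomial.mem_roots hmonic.ne_zero).mp hr
    simp [p, hn] at this
  refine ⟨Units.mk0 r hr0, ?_⟩
  rw [mem_principalUnits, ← key]
  exact hpos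

theorem const_eq_one_of_mem {b : ℂˣ}
    (h : Units.map (algebraMap ℂ F).toMonoidHom b ∈ v.principalUnits) : b = 1 := by
  by_contra hb
  have h1 : v (algebraMap ℂ F ((b : ℂ) - 1)) = 0 := hv _ (by
    rw [sub_ne_zero]; exact fun h => hb (Units.ext h))
  rw [_root_.map_sub, _root_.map_one] at h1
  exact absurd h1 (ne_of_gt h)

theorem aeval_sub_pos {σ : Type*} {x : σ → F} {x₀ : σ → ℂ}
    (h : ∀ i, 0 < v (x i - algebraMap ℂ F (x₀ i))) (p : MvPolynomial σ ℂ) :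
    0 < v (MvPolynomial.aeval x p - algebraMap ℂ F (MvPolynomial.aeval x₀ p)) := by
  induction p using MvPolynomial.induction_on with
  | C z => simp
  | add p q hp hq =>
    rw [_root_.map_add, _root_.map_add, _root_.map_add, add_sub_add_comm]
    exact v.map_lt_add hp hq
  | mul_X p i hp =>
    rw [_root_.map_mul, _root_.map_mul, _root_.map_mul, MvPolynomial.aeval_X,
      MvPolynomial.aeval_X]
    have : MvPolynomial.aeval x p * x i -
        algebraMap ℂ F (MvPolynomial.aeval x₀ p) * algebraMap ℂ F (x₀ i) =
        (MvPolynomial.aeval x p - algebraMap ℂ F (MvPolynomial.aeval x₀ p)) * x i +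
          algebraMap ℂ F (MvPolynomial.aeval x₀ p) * (x i - algebraMap ℂ F (x₀ i)) := by ring
    rw [this]
    refine v.map_lt_add ?_ ?_
    · rw [v.map_mul]
      exact hp.trans_le (le_add_of_nonneg_right
        (v.nonneg_of_sub_pos (v.const_nonneg hv _) (h i)))
    · rw [v.map_mul]
      exact (h i).trans_le (le_add_of_nonneg_left (v.const_nonneg hv _))

end AddValuation

/-! ### Solutions over a valued field and the valuation of a branch -/

namespace TorusSystem

variable {ι : Type} [Fintype ι] [DecidableEq ι] {T : TorusSystem ι}
variable {F : Type} [Field F] [Algebra ℂ F] {v : AddValuation F (WithTop ℤ)}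

theorem IsSolution.w_mem_principalUnits {y w : ι → Fˣ} {τ : F} (h : T.IsSolution y w τ)
    (hτ : 0 < v τ) (hy : ∀ ν, v (y ν : F) = 0) (ν : ι) : w ν ∈ v.principalUnits := by
  rw [AddValuation.mem_principalUnits, h.w_eq, sub_sub_cancel_left, v.map_neg, v.map_mul, hy,
    zero_add, v.map_pow]
  exact nsmul_pos hτ (T.a_pos ν).ne'

/-- The `w ν` are congruent to 1, so `y ^ B` is congruent to `ε`, and by the adjugate each `y ν ^
det B` is congruent to a constant. Hence each `y ν` is congruent to a constant, and reduction of the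
equations shows that these constants form a center. -/
theorem IsSolution.exists_center (hv : ∀ z : ℂ, z ≠ 0 → v (algebraMap ℂ F z) = 0)
    {y w : ι → Fˣ} {τ : F} (h : T.IsSolution y w τ)
    (hτ : 0 < v τ) (hy : ∀ ν, v (y ν : F) = 0) :
    ∃ c : T.Center, ∀ ν, y ν * (Units.map (algebraMap ℂ F).toMonoidHom (c.1 ν))⁻¹ ∈
      v.principalUnits := by
  have hw := h.w_mem_principalUnits hτ hy
  let κ : ℂˣ →* Fˣ := Units.map (algebraMap ℂ F).toMonoidHom
  have hyB : monomialHom T.B y = (fun j => κ (T.ε j)) * (monomialHom T.S w)⁻¹ := by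
    ext1 j
    rw [Pi.mul_apply, Pi.inv_apply, eq_mul_inv_iff_mul_eq, h.eqn j]
  have hdet := pow_det_eq T.B y
  rw [hyB, _root_.map_mul, _root_.map_inv, ← monomialHom_mul] at hdet
  have hroot : ∀ ν, ∃ r : ℂˣ, y ν * (κ r)⁻¹ ∈ v.principalUnits := by
    intro ν
    have h1 := congrFun hdet ν
    rw [Pi.pow_apply, Pi.mul_apply, Pi.inv_apply, ← map_monomialHom] at h1
    have h2 := v.monomialHom_mem_principalUnits (T.B.adjugate * T.S) hw ν
    set e := monomialHom T.B.adjugate T.ε ν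
    rcases Int.natAbs_eq T.B.det with hd | hd
    · refine AddValuation.exists_const_of_pow_mem hv (b := e)
        (Int.natAbs_ne_zero.mpr T.det_ne) ?_
      rw [hd, zpow_natCast] at h1
      rw [h1]
      change κ e * _ * (κ e)⁻¹ ∈ _
      rw [mul_inv_cancel_comm]
      exact inv_mem h2
    · refine AddValuation.exists_const_of_pow_mem hv (b := e⁻¹)
        (Int.natAbs_ne_zero.mpr T.det_ne) ?_
      rw [hd, zpow_neg, zpow_natCast, inv_eq_iff_eq_inv] at h1
      rw [h1]
      change _ * (κ e⁻¹)⁻¹ ∈ _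
      rw [_root_.map_inv, inv_inv, mul_inv, inv_inv, mul_comm, mul_inv_cancel_left]
      exact h2
  choose r hr using hroot
  refine ⟨⟨r, ?_⟩, hr⟩
  ext1 j
  have h1 := v.monomialHom_mem_principalUnits T.B hr j
  have h2 := v.monomialHom_mem_principalUnits T.S hw j
  have h3 := mul_mem h1 h2
  have h4 : monomialHom T.B (fun ν => y ν * (κ (r ν))⁻¹) j * monomialHom T.S w j =
      κ (T.ε j * (monomialHom T.B r j)⁻¹) := by
    have : (fun ν => y ν * (κ (r ν))⁻¹) = y * (fun ν => κ (r ν))⁻¹ := rfl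
    rw [this, _root_.map_mul, _root_.map_inv, hyB, Pi.mul_apply, Pi.mul_apply, Pi.inv_apply,
      Pi.inv_apply, ← map_monomialHom, _root_.map_mul, _root_.map_inv]
    rw [mul_right_comm, inv_mul_cancel_right]
  rw [h4] at h3
  have h5 := AddValuation.const_eq_one_of_mem hv h3
  rw [mul_inv_eq_one] at h5
  exact h5.symm

/-- The normalized valuation of the function field of a branch. -/
theorem exists_branchVal (c : T.Center) : ∃ v : AddValuation (BranchField c) (WithTop ℤ),
    (∀ a, 0 ≤ v (toBranchField c a)) ∧ v (toBranchField c (T.solutionBranch c.1).τ) = 1 := by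
  obtain ⟨v, h1, h2⟩ :=
    IsDiscreteValuationRing.exists_addValuation (T.SolutionRing c.1) (BranchField c)
  exact ⟨v, h1, h2 _ (irreducible_tau c)⟩

/-- The normalized valuation of the function field of a branch. -/
def branchVal (c : T.Center) : AddValuation (BranchField c) (WithTop ℤ) :=
  (exists_branchVal c).choose

theorem branchVal_nonneg (c : T.Center) (a : T.SolutionRing c.1) :
    0 ≤ branchVal c (toBranchField c a) :=
  (exists_branchVal c).choose_spec.1 a

theorem branchVal_tau (c : T.Center) :
    branchVal c (toBranchField c (T.solutionBranch c.1).τ) = 1 :=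
  (exists_branchVal c).choose_spec.2

theorem branchVal_unit (c : T.Center) (u : (T.SolutionRing c.1)ˣ) :
    branchVal c (toBranchField c u) = 0 :=
  AddValuation.map_unit_eq_zero _ (branchVal_nonneg c) u

theorem branchVal_const (c : T.Center) (z : ℂ) (hz : z ≠ 0) :
    branchVal c (algebraMap ℂ _ z) = 0 := by
  have := branchVal_unit c (Units.map (algebraMap ℂ (T.SolutionRing c.1)).toMonoidHom
    (Units.mk0 z hz))
  rw [← this]
  congr 1

theorem exists_eq_unit_mul_zpow (c : T.Center) {x : BranchField c} (hx : x ≠ 0) :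
    ∃ (n : ℤ) (u : (T.SolutionRing c.1)ˣ),
      x = toBranchField c u * toBranchField c (T.solutionBranch c.1).τ ^ n := by
  obtain ⟨n, u, h⟩ := IsDiscreteValuationRing.exists_units_eq_smul_zpow_of_irreducible
    (irreducible_tau c) hx
  refine ⟨n, u, ?_⟩
  rw [h, Units.smul_def, Algebra.smul_def]
  rfl

theorem map_zpow_eq {K : Type*} [Field K] (v : AddValuation K (WithTop ℤ)) {x : K} {k : ℤ}
    (hx : v x = k) (n : ℤ) : v (x ^ n) = ((n * k : ℤ) : WithTop ℤ) := by
  have hnat : ∀ n : ℕ, v (x ^ n) = ((n * k : ℤ) : WithTop ℤ) := fun n => by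
    rw [v.map_pow, hx, ← WithTop.coe_nsmul, nsmul_eq_mul]
  cases n with
  | ofNat n => rw [Int.ofNat_eq_natCast, zpow_natCast]; exact hnat n
  | negSucc n =>
    rw [zpow_negSucc, v.map_inv, hnat (n + 1), Int.negSucc_eq]
    rw [neg_mul]
    norm_cast

/-- A solution over a valued field near a center comes from the branch through the center, and
the valuation is proportional to that of the branch. -/
theorem IsSolution.exists_branch_hom (hv : ∀ z : ℂ, z ≠ 0 → v (algebraMap ℂ F z) = 0)
    {y w : ι → Fˣ} {τ : F} (h : T.IsSolution y w τ) {k : ℤ} (hk : 0 < k) (hτ : v τ = k)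
    (c : T.Center) (hy : ∀ ν, y ν * (Units.map (algebraMap ℂ F).toMonoidHom (c.1 ν))⁻¹ ∈
      v.principalUnits) :
    ∃ φ : BranchField c →ₐ[ℂ] F, φ (toBranchField c (T.solutionBranch c.1).τ) = τ ∧
      (∀ ν, φ (toBranchField c ((T.solutionBranch c.1).y ν)) = y ν) ∧
      ∀ x ≠ 0, ∃ n : ℤ, branchVal c x = n ∧ v (φ x) = ((n * k : ℤ) : WithTop ℤ) := by
  have hpos : ∀ i, 0 < v (coords (fun ν => (y ν : F)) τ i -
      algebraMap ℂ F (centerPoint c.1 i)) := by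
    rintro (_ | ν)
    · simp only [coords, centerPoint, _root_.map_zero, sub_zero, hτ]
      exact_mod_cast hk
    · have hc : algebraMap ℂ F (c.1 ν) ≠ 0 :=
        (map_ne_zero_iff _ (algebraMap ℂ F).injective).mpr (c.1 ν).ne_zero
      have h1 : (y ν : F) - algebraMap ℂ F (c.1 ν) =
          (((y ν * (Units.map (algebraMap ℂ F).toMonoidHom (c.1 ν))⁻¹ : Fˣ) : F) - 1) *
            algebraMap ℂ F (c.1 ν) := by
        rw [Units.val_mul, Units.val_inv_eq_inv_val]
        change _ = ((y ν : F) * (algebraMap ℂ F (c.1 ν))⁻¹ - 1) * algebraMap ℂ F (c.1 ν)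
        field_simp
      change 0 < v ((y ν : F) - algebraMap ℂ F (c.1 ν))
      rw [h1, v.map_mul, hv _ (c.1 ν).ne_zero, add_zero]
      exact hy ν
  have hpoly := AddValuation.aeval_sub_pos hv hpos
  -- A polynomial is congruent to its value at the center; if this value is nonzero, the polynomial
  -- becomes invertible in `F`, as the universal property requires.
  have hunit : ∀ g : MvPolynomial (Option ι) ℂ, MvPolynomial.aeval (centerPoint c.1) g ≠ 0 →
      v (MvPolynomial.aeval (coords (fun ν => (y ν : F)) τ) g) = 0 := by
    intro g hg
    have h0 := hv _ hg
    rw [v.map_eq_of_lt_sub (by rw [h0]; exact hpoly g), h0]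
  have hne : ∀ {x : F}, v x = 0 → x ≠ 0 := by
    rintro x hx rfl
    simp at hx
  obtain ⟨φ, hφτ, hφy⟩ := (T.solutionBranch c.1).lift y w τ h fun g hg =>
    (hne (hunit g hg)).isUnit
  have hnonneg : ∀ a, 0 ≤ v (φ a) := by
    intro a
    obtain ⟨f, g, hg, hfg⟩ := (T.solutionBranch c.1).surj a
    have h1 := congrArg (fun x => v (φ x)) hfg
    simp only [_root_.map_mul, v.map_mul, map_aeval_coords, hφτ, hφy] at h1
    rw [hunit g hg, add_zero] at h1
    rw [h1]
    exact v.nonneg_of_sub_pos (v.const_nonneg hv _) (hpoly f)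
  have hφunit : ∀ u : (T.SolutionRing c.1)ˣ, v (φ u) = 0 := by
    let _ : Algebra (T.SolutionRing c.1) F := φ.toRingHom.toAlgebra
    exact fun u => AddValuation.map_unit_eq_zero v hnonneg u
  have hτ0 : τ ≠ 0 := by
    rintro rfl
    simp at hτ
  -- A nonzero element is a unit times a power of `τ`, and neither factor goes to zero.
  have hinj : Function.Injective φ := by
    rw [injective_iff_map_eq_zero]
    intro a ha
    by_contra ha0
    obtain ⟨n, u, rfl⟩ := IsDiscreteValuationRing.eq_unit_mul_pow_irreducible ha0
      (irreducible_tau c)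
    rw [_root_.map_mul, _root_.map_pow, hφτ] at ha
    exact mul_ne_zero (hne (hφunit u)) (pow_ne_zero n hτ0) ha
  let Φ : BranchField c →ₐ[ℂ] F := IsFractionRing.liftAlgHom hinj
  have hΦ : ∀ a, Φ (toBranchField c a) = φ a := fun a => IsFractionRing.lift_algebraMap hinj a
  refine ⟨Φ, by rw [hΦ, hφτ], fun ν => by rw [hΦ, hφy], fun x hx => ?_⟩
  obtain ⟨n, u, rfl⟩ := exists_eq_unit_mul_zpow c hx
  refine ⟨n, ?_, ?_⟩
  · rw [AddValuation.map_mul, branchVal_unit, zero_add, map_zpow_eq _ (k := 1)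
      (by rw [branchVal_tau]; rfl), mul_one]
  · rw [_root_.map_mul, _root_.map_zpow₀, hΦ, hΦ, hφτ, v.map_mul, hφunit, zero_add,
      map_zpow_eq v hτ]

end TorusSystem

end

noncomputable section

/-! ### The toric system attached to a degeneration -/

/-- Here `s` is the common sign of the entries, `a = |d| / g`, and `l` consists of Bézout
coefficients for `a`. -/
theorem exists_primitive_weights {n : ℕ} (d : Fin (n + 1) → ℤ)
    (hd : (∀ ν, 0 < d ν) ∨ (∀ ν, d ν < 0)) :
    ∃ (g : ℕ) (s : ℤ) (a : Fin (n + 1) → ℕ) (l : Fin (n + 1) → ℤ),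
      g = Finset.univ.gcd (fun ν => (d ν).natAbs) ∧ g ≠ 0 ∧ s.natAbs = 1 ∧ (∀ ν, 0 < a ν) ∧
      (∀ ν, d ν = s * g * a ν) ∧ ∑ ν, l ν * a ν = 1 := by
  set g := Finset.univ.gcd (fun ν => (d ν).natAbs) with hg
  have hd0 : ∀ ν, d ν ≠ 0 := fun ν => by rcases hd with h | h <;> have := h ν <;> omega
  have hgd : ∀ ν, g ∣ (d ν).natAbs := fun ν => Finset.gcd_dvd (Finset.mem_univ ν)
  have hg0 : g ≠ 0 := by
    intro h
    have := hgd 0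
    rw [h, zero_dvd_iff, Int.natAbs_eq_zero] at this
    exact hd0 0 this
  choose a ha using hgd
  obtain ⟨s, hs, hsd⟩ : ∃ s : ℤ, s.natAbs = 1 ∧ ∀ ν, d ν = s * (d ν).natAbs := by
    rcases hd with h | h
    · exact ⟨1, rfl, fun ν => by have := h ν; omega⟩
    · exact ⟨-1, rfl, fun ν => by have := h ν; omega⟩
  have hda : ∀ ν, d ν = s * g * a ν := fun ν => by
    rw [hsd ν, ha ν, Nat.cast_mul, mul_assoc]
  obtain ⟨e, he⟩ := IsPrincipalIdealRing.principal (Ideal.span (Set.range d))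
  have hed : ∀ ν, e ∣ d ν := fun ν => by
    have : d ν ∈ Ideal.span (Set.range d) := Ideal.subset_span ⟨ν, rfl⟩
    rw [he] at this
    exact Ideal.mem_span_singleton.mp this
  have heg : e.natAbs ∣ g := Finset.dvd_gcd fun ν _ => Int.natAbs_dvd_natAbs.mpr (hed ν)
  have hmem : e ∈ Ideal.span (Set.range d) := he ▸ Ideal.mem_span_singleton_self e
  obtain ⟨l, hl⟩ := Ideal.mem_span_range_iff_exists_fun.mp hmem
  have hsum : e = s * g * ∑ ν, l ν * a ν := by
    rw [← hl, Finset.mul_sum]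
    exact Finset.sum_congr rfl fun ν _ => by rw [hda ν]; ring
  have hunit : (∑ ν, l ν * a ν).natAbs = 1 := by
    have h1 : e.natAbs = g * (∑ ν, l ν * a ν).natAbs := by
      rw [hsum, Int.natAbs_mul, Int.natAbs_mul, hs, one_mul, Int.natAbs_natCast]
    rw [h1] at heg
    exact Nat.dvd_one.mp (Nat.dvd_of_mul_dvd_mul_left (Nat.pos_of_ne_zero hg0)
      (by rwa [mul_one]))
  -- The sum `l · a` is only known to be `± 1`; multiplying `l` by it makes the sum a square, hence
  -- 1.
  refine ⟨g, s, a, fun ν => (∑ ν, l ν * a ν) * l ν, rfl, hg0, hs, fun ν => ?_, hda, ?_⟩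
  · refine Nat.pos_of_ne_zero fun h => hd0 ν ?_
    rw [hda ν, h]; simp
  · simp only [mul_assoc, ← Finset.mul_sum]
    rcases Int.natAbs_eq (∑ ν, l ν * a ν) with h | h <;> rw [h, hunit] <;> rfl

namespace IdealTriangulation

variable {m : ℕ} (K : IdealTriangulation (m + 1)) (E : Fin (m + 1) ≃ K.Edge)
  (I : Fin (m + 1) → Degeneration)

/-- Laplace expansion along the added row, whose cofactors are the entries of `d(I)`. -/
theorem det_cons_degenerationMatrix (l : Fin (m + 1) → ℤ) :
    (Matrix.of (Fin.cons l (K.degenerationMatrix E I) : Fin (m + 1) → Fin (m + 1) → ℤ)).det =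
      ∑ ν, l ν * K.degenerationVector E I ν := by
  rw [Matrix.det_succ_row_zero]
  refine Finset.sum_congr rfl fun ν _ => ?_
  have h : (Matrix.of (Fin.cons l (K.degenerationMatrix E I) :
      Fin (m + 1) → Fin (m + 1) → ℤ)).submatrix Fin.succ ν.succAbove =
      (K.degenerationMatrix E I).submatrix id ν.succAbove := rfl
  have h0 : (Matrix.of (Fin.cons l (K.degenerationMatrix E I) :
      Fin (m + 1) → Fin (m + 1) → ℤ)) 0 ν = l ν := rfl
  rw [h, h0, degenerationVector]
  ring

/-- The sum is the determinant of `R(I)` with its row `j` repeated on top. -/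
theorem sum_degenerationMatrix_mul_degenerationVector (j : Fin m) :
    ∑ ν, K.degenerationMatrix E I j ν * K.degenerationVector E I ν = 0 := by
  rw [← det_cons_degenerationMatrix]
  refine Matrix.det_zero_of_row_eq (i := 0) (j := j.succ) (Fin.succ_ne_zero j).symm ?_
  ext ν
  rfl

/-- A one-parameter subgroup of the kernel of the degeneration matrix, with a character `l`
splitting it. -/
structure Weights where
  a : Fin (m + 1) → ℕ
  l : Fin (m + 1) → ℤ
  a_pos : ∀ ν, 0 < a ν
  sum_l : ∑ ν, l ν * a ν = 1
  sum_R : ∀ j, ∑ ν, K.degenerationMatrix E I j ν * a ν = 0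
  det_ne : (Matrix.of (Fin.cons l (K.degenerationMatrix E I) :
    Fin (m + 1) → Fin (m + 1) → ℤ)).det ≠ 0

/-- From `d(I) = ± g a` follow `R(I) a = 0` and `det B = l · d(I) = ± g (l · a) = ± g`. -/
theorem exists_weights
    (hd : (∀ ν, 0 < K.degenerationVector E I ν) ∨ (∀ ν, K.degenerationVector E I ν < 0)) :
    ∃ W : K.Weights E I, (Matrix.of (Fin.cons W.l (K.degenerationMatrix E I) :
      Fin (m + 1) → Fin (m + 1) → ℤ)).det.natAbs =
        Finset.univ.gcd fun ν => (K.degenerationVector E I ν).natAbs := by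
  obtain ⟨g, s, a, l, hg, hg0, hs, ha, hda, hl⟩ := exists_primitive_weights _ hd
  have hs0 : s ≠ 0 := by rintro rfl; simp at hs
  have hsg : s * (g : ℤ) ≠ 0 := mul_ne_zero hs0 (by exact_mod_cast hg0)
  have hdet : (Matrix.of (Fin.cons l (K.degenerationMatrix E I) :
      Fin (m + 1) → Fin (m + 1) → ℤ)).det = s * g := by
    rw [det_cons_degenerationMatrix, ← mul_one (s * (g : ℤ)), ← hl, Finset.mul_sum]
    exact Finset.sum_congr rfl fun ν _ => by rw [hda ν]; ring
  refine ⟨⟨a, l, ha, hl, fun j => ?_, by rwa [hdet]⟩, ?_⟩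
  · have h := sum_degenerationMatrix_mul_degenerationVector K E I j
    have h2 : s * (g : ℤ) * ∑ ν, K.degenerationMatrix E I j ν * a ν = 0 := by
      rw [← h, Finset.mul_sum]
      exact Finset.sum_congr rfl fun ν _ => by rw [hda ν]; ring
    exact (mul_eq_zero.mp h2).resolve_left hsg
  · rw [← hg]
    change (Matrix.of (Fin.cons l (K.degenerationMatrix E I) :
      Fin (m + 1) → Fin (m + 1) → ℤ)).det.natAbs = g
    rw [hdet, Int.natAbs_mul, hs, one_mul, Int.natAbs_natCast]

/-- The exponents of `1 - u` in the gluing equations, where `u` is the coordinate vanishing at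
the degeneration. -/
def unitMatrix : Matrix (Fin m) (Fin (m + 1)) ℤ :=
  Matrix.of fun j ν =>
    match I ν with
    | .one => K.r' (E j.castSucc) ν
    | .zero => K.r'' (E j.castSucc) ν
    | .infty => K.r'' (E j.castSucc) ν

/-- The exponents of `-1` in the gluing equations. -/
def signExponent (j : Fin m) (ν : Fin (m + 1)) : ℕ :=
  match I ν with
  | .one => K.p'' (E j.castSucc) ν
  | .zero => K.p'' (E j.castSucc) ν
  | .infty => K.p' (E j.castSucc) ν

variable {K E I}

/-- The toric system equivalent to the gluing equations near a degeneration. -/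
def Weights.system (W : K.Weights E I) : TorusSystem (Fin (m + 1)) where
  -- Row 0 encodes `τ = u ^ l`: with `u = y τ ^ a` and `l · a = 1` it reads `y ^ l = 1`. In the
  -- other rows `R(I) a = 0`, so `τ` survives only inside `1 - u`.
  B := Matrix.of (Fin.cons W.l (K.degenerationMatrix E I))
  S := Matrix.of (Fin.cons 0 (K.unitMatrix E I))
  ε := Fin.cons 1 fun j => ∏ ν, (-1) ^ K.signExponent E I j ν
  a := W.a
  det_ne := W.det_ne
  a_pos := W.a_pos

end IdealTriangulation

/-! ### Shape parameters near a degeneration -/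

namespace Degeneration

/-- The parameter `z`, in terms of the vanishing coordinate `u` and of `s = 1 - u`. -/
def zOf {G : Type*} [CommGroup G] (u s : G) : Degeneration → G
  | .one => s
  | .zero => u
  | .infty => u⁻¹

/-- The parameter `w = 1 - z`, in terms of the vanishing coordinate `u` and of `s = 1 - u`. -/
def wOf {G : Type*} [CommGroup G] [HasDistribNeg G] (u s : G) : Degeneration → G
  | .one => u
  | .zero => s
  | .infty => -(s * u⁻¹)

/-- The coordinate which vanishes at the degeneration. -/
def uOf {F : Type*} [Field F] (z w : F) : Degeneration → F
  | .one => w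
  | .zero => z
  | .infty => z⁻¹

theorem uOf_zOf_wOf {F : Type*} [Field F] (u s : Fˣ) (i : Degeneration) :
    uOf ((zOf u s i : Fˣ) : F) ((wOf u s i : Fˣ) : F) i = u := by
  cases i <;> simp [uOf, zOf, wOf]

theorem zOf_add_wOf {F : Type*} [Field F] {u s : Fˣ} (h : (s : F) = 1 - u) (i : Degeneration) :
    ((zOf u s i : Fˣ) : F) + ((wOf u s i : Fˣ) : F) = 1 := by
  have hu := u.ne_zero
  cases i
  · simp [zOf, wOf, h]
  · simp [zOf, wOf, h]
  · simp only [zOf, wOf, Units.val_neg, Units.val_mul, Units.val_inv_eq_inv_val, h]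
    field_simp
    ring

theorem zOf_uOf {F : Type*} [Field F] {z w : F} (hzw : z + w = 1) {u s : Fˣ} {i : Degeneration}
    (hu : (u : F) = uOf z w i) (hs : (s : F) = 1 - u) : ((zOf u s i : Fˣ) : F) = z := by
  cases i
  · simp only [zOf, hs, hu, uOf]
    linear_combination -hzw
  · simp [zOf, hu, uOf]
  · simp [zOf, hu, uOf]

theorem wOf_uOf {F : Type*} [Field F] {z w : F} (hzw : z + w = 1) {u s : Fˣ} {i : Degeneration}
    (hu : (u : F) = uOf z w i) (hs : (s : F) = 1 - u) : ((wOf u s i : Fˣ) : F) = w := by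
  have h1 := zOf_add_wOf hs i
  rw [zOf_uOf hzw hu hs] at h1
  linear_combination h1 - hzw

end Degeneration

namespace IdealTriangulation

variable {m : ℕ} {K : IdealTriangulation (m + 1)} {E : Fin (m + 1) ≃ K.Edge}
  {I : Fin (m + 1) → Degeneration}

/-- For the limits 1 and 0 the only sign comes from `z'' = -w / z`. For the limit `∞` one has `z'' =
s` and `z' = -u / s`, so the sign comes from `z'` instead. -/
theorem gluing_factor_eq {G : Type*} [CommGroup G] [HasDistribNeg G] (u s : G) (j : Fin m) (ν : Fin (m + 1)) :
    (Degeneration.zOf u s (I ν)) ^ K.p (E j.castSucc) ν *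
      (Degeneration.wOf u s (I ν))⁻¹ ^ K.p' (E j.castSucc) ν *
      (-Degeneration.wOf u s (I ν) * (Degeneration.zOf u s (I ν))⁻¹) ^ K.p'' (E j.castSucc) ν =
    (-1) ^ K.signExponent E I j ν * (u ^ K.degenerationMatrix E I j ν *
      s ^ K.unitMatrix E I j ν) := by
  simp only [degenerationMatrix, unitMatrix, signExponent, Matrix.of_apply, r', r'']
  generalize K.p (E j.castSucc) ν = a
  generalize K.p' (E j.castSucc) ν = b
  generalize K.p'' (E j.castSucc) ν = c
  rcases I ν with _ | _ | _ <;> simp only [Degeneration.zOf, Degeneration.wOf]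
  · rw [← neg_one_mul, mul_assoc (-1 : G), mul_pow (-1 : G), mul_pow]
    simp only [zpow_sub, zpow_natCast, inv_pow]
    generalize (-1 : G) ^ c = q
    ac_rfl
  · rw [← neg_one_mul, mul_assoc (-1 : G), mul_pow (-1 : G), mul_pow]
    simp only [zpow_sub, zpow_natCast, inv_pow]
    generalize (-1 : G) ^ c = q
    generalize s ^ c = t
    generalize u ^ a = r
    ac_rfl
  · have h1 : -(-(s * u⁻¹)) * u⁻¹⁻¹ = s := by simp
    have h2 : (-(s * u⁻¹))⁻¹ = (-1) * (s⁻¹ * u) := by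
      rw [inv_neg, mul_inv, inv_inv, neg_one_mul]
    have h3 : -((a : ℤ) - c) - (c - b) = b - a := by ring
    rw [h1, h2, h3, mul_pow, mul_pow]
    simp only [zpow_sub, zpow_natCast, inv_pow]
    generalize (-1 : G) ^ b = q
    ac_rfl

theorem neg_one_pow_prod_mul_self {G : Type*} [CommGroup G] [HasDistribNeg G] {ι : Type*}
    [Fintype ι] (e : ι → ℕ) : (∏ ν, (-1 : G) ^ e ν) * ∏ ν, (-1 : G) ^ e ν = 1 := by
  rw [← Finset.prod_mul_distrib]
  exact Finset.prod_eq_one fun ν _ => by rw [← mul_pow]; simp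

theorem prod_gluing_factor_eq_one_iff {F : Type*} [Field F] [Algebra ℂ F] (W : K.Weights E I)
    (u s : Fin (m + 1) → Fˣ) (j : Fin m) :
    ∏ ν, ((Degeneration.zOf (u ν) (s ν) (I ν)) ^ K.p (E j.castSucc) ν *
      (Degeneration.wOf (u ν) (s ν) (I ν))⁻¹ ^ K.p' (E j.castSucc) ν *
      (-Degeneration.wOf (u ν) (s ν) (I ν) * (Degeneration.zOf (u ν) (s ν) (I ν))⁻¹) ^
        K.p'' (E j.castSucc) ν) = 1 ↔
    monomialHom W.system.B u j.succ * monomialHom W.system.S s j.succ =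
      Units.map (algebraMap ℂ F).toMonoidHom (W.system.ε j.succ) := by
  simp only [gluing_factor_eq, Finset.prod_mul_distrib]
  have h1 : Units.map (algebraMap ℂ F).toMonoidHom (W.system.ε j.succ) =
      ∏ ν, (-1 : Fˣ) ^ K.signExponent E I j ν := by
    have : W.system.ε j.succ = ∏ ν, (-1) ^ K.signExponent E I j ν := rfl
    rw [this, map_prod]
    refine Finset.prod_congr rfl fun ν _ => ?_
    rw [map_pow]
    congr 1
    ext
    simp
  have h2 : monomialHom W.system.B u j.succ = ∏ ν, u ν ^ K.degenerationMatrix E I j ν := rfl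
  have h3 : monomialHom W.system.S s j.succ = ∏ ν, s ν ^ K.unitMatrix E I j ν := rfl
  rw [h1, h2, h3, mul_eq_one_iff_inv_eq, inv_eq_of_mul_eq_one_right
    (neg_one_pow_prod_mul_self _), eq_comm]

/-! ### The equations of the deformation variety over a field -/

variable (K E) in
/-- The defining equations of the deformation variety, with denominators cleared. -/
structure IsDeformation {F : Type*} [Field F] (x : Coord (m + 1) → F) : Prop where
  glue : ∀ j : Fin m, ∏ ν, (x (zIdx ν) ^ K.p (E j.castSucc) ν *
      (-x (wIdx ν)) ^ K.p'' (E j.castSucc) ν) =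
    ∏ ν, (x (wIdx ν) ^ K.p' (E j.castSucc) ν * x (zIdx ν) ^ K.p'' (E j.castSucc) ν)
  add : ∀ ν, x (zIdx ν) + x (wIdx ν) = 1
  mul : (∏ ν, x (zIdx ν)) * (∏ ν, x (wIdx ν)) * x tIdx = 1

theorem IsDeformation.z_ne_zero {F : Type*} [Field F] {x : Coord (m + 1) → F}
    (h : IsDeformation K E x) (ν : Fin (m + 1)) : x (zIdx ν) ≠ 0 := by
  intro h0
  have := h.mul
  rw [Finset.prod_eq_zero (Finset.mem_univ ν) h0] at this
  simp at this

theorem IsDeformation.w_ne_zero {F : Type*} [Field F] {x : Coord (m + 1) → F}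
    (h : IsDeformation K E x) (ν : Fin (m + 1)) : x (wIdx ν) ≠ 0 := by
  intro h0
  have := h.mul
  rw [Finset.prod_eq_zero (f := fun ν => x (wIdx ν)) (Finset.mem_univ ν) h0] at this
  simp at this

theorem prod_gluing_eq_one_iff {F ι : Type*} [Field F] [Fintype ι] {z w : ι → F} (a b c : ι → ℕ)
    (hz : ∀ ν, z ν ≠ 0) (hw : ∀ ν, w ν ≠ 0) :
    ∏ ν, (z ν ^ a ν * (w ν)⁻¹ ^ b ν * (-w ν * (z ν)⁻¹) ^ c ν) = 1 ↔
      ∏ ν, (z ν ^ a ν * (-w ν) ^ c ν) = ∏ ν, (w ν ^ b ν * z ν ^ c ν) := by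
  have h0 : ∏ ν, (w ν ^ b ν * z ν ^ c ν) ≠ 0 := Finset.prod_ne_zero_iff.mpr fun ν _ =>
    mul_ne_zero (pow_ne_zero _ (hw ν)) (pow_ne_zero _ (hz ν))
  have h1 : ∏ ν, (z ν ^ a ν * (w ν)⁻¹ ^ b ν * (-w ν * (z ν)⁻¹) ^ c ν) =
      (∏ ν, (z ν ^ a ν * (-w ν) ^ c ν)) / ∏ ν, (w ν ^ b ν * z ν ^ c ν) := by
    rw [← Finset.prod_div_distrib]
    refine Finset.prod_congr rfl fun ν _ => ?_
    rw [mul_pow, inv_pow, inv_pow]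
    have := hz ν
    have := hw ν
    field_simp
  rw [h1, div_eq_one_iff_eq h0]

/-- The equation involving `t` makes all `z ν` and `w ν` nonzero, so clearing denominators loses
nothing. -/
theorem mem_deformationVariety_iff (x : Coord (m + 1) → ℂ) :
    x ∈ K.deformationVariety E ↔ IsDeformation K E x := by
  have key : ∀ (hz : ∀ ν, x (zIdx ν) ≠ 0) (hw : ∀ ν, x (wIdx ν) ≠ 0) (j : Fin m),
      K.gluingProduct (E j.castSucc) (fun ν => x (zIdx ν)) (fun ν => x (wIdx ν)) = 1 ↔ _ :=
    fun hz hw j => by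
      simp only [gluingProduct, div_eq_mul_inv, one_mul]
      exact prod_gluing_eq_one_iff (z := fun ν => x (zIdx ν)) (w := fun ν => x (wIdx ν))
        (fun ν => K.p (E j.castSucc) ν) (fun ν => K.p' (E j.castSucc) ν)
        (fun ν => K.p'' (E j.castSucc) ν) hz hw
  constructor
  · rintro ⟨h1, h2, h3⟩
    have hz : ∀ ν, x (zIdx ν) ≠ 0 := fun ν h0 => by
      rw [Finset.prod_eq_zero (Finset.mem_univ ν) h0] at h3
      simp at h3
    have hw : ∀ ν, x (wIdx ν) ≠ 0 := fun ν h0 => by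
      rw [Finset.prod_eq_zero (f := fun ν => x (wIdx ν)) (Finset.mem_univ ν) h0] at h3
      simp at h3
    exact ⟨fun j => (key hz hw j).mp (h1 j), h2, h3⟩
  · intro h
    exact ⟨fun j => (key h.z_ne_zero h.w_ne_zero j).mpr (h.glue j), h.add, h.mul⟩

open MvPolynomial in
variable (K E) in
/-- Polynomials defining the deformation variety. -/
def deformationPolynomials : Set (MvPolynomial (Coord (m + 1)) ℂ) :=
  Set.range (fun j : Fin m =>
    ∏ ν, (X (zIdx ν) ^ K.p (E j.castSucc) ν * (-X (wIdx ν)) ^ K.p'' (E j.castSucc) ν) -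
    ∏ ν, (X (wIdx ν) ^ K.p' (E j.castSucc) ν * X (zIdx ν) ^ K.p'' (E j.castSucc) ν)) ∪
  Set.range (fun ν : Fin (m + 1) => X (zIdx ν) + X (wIdx ν) - 1) ∪
  {(∏ ν, X (zIdx ν)) * (∏ ν, X (wIdx ν)) * X tIdx - 1}

/-- In polynomial form the equations pass along `ℂ`-algebra homomorphisms and can be tested in a
vanishing ideal. -/
theorem isDeformation_iff {F : Type*} [Field F] [Algebra ℂ F] (x : Coord (m + 1) → F) :
    IsDeformation K E x ↔ ∀ q ∈ deformationPolynomials K E, MvPolynomial.aeval x q = 0 := by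
  constructor
  · rintro h q ((⟨j, rfl⟩ | ⟨ν, rfl⟩) | rfl)
    · simpa [sub_eq_zero] using h.glue j
    · simpa [sub_eq_zero] using h.add ν
    · simpa [sub_eq_zero] using h.mul
  · intro h
    refine ⟨fun j => ?_, fun ν => ?_, ?_⟩
    · simpa [sub_eq_zero] using h _ (Or.inl (Or.inl ⟨j, rfl⟩))
    · simpa [sub_eq_zero] using h _ (Or.inl (Or.inr ⟨ν, rfl⟩))
    · simpa [sub_eq_zero] using h _ (Or.inr rfl)

end IdealTriangulation

end

/-! ### Toric coordinates on the deformation variety and generic points of branches -/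

noncomputable section

namespace AddValuation

variable {F : Type*} [Field F] (v : AddValuation F (WithTop ℤ))

theorem exists_eq_coe {x : F} (hx : x ≠ 0) : ∃ n : ℤ, v x = n := by
  obtain ⟨n, hn⟩ := WithTop.ne_top_iff_exists.mp (v.ne_top_iff.mpr hx)
  exact ⟨n, hn.symm⟩

theorem map_prod_eq {ι : Type*} {f : ι → F} {n : ι → ℤ} (h : ∀ i, v (f i) = n i)
    (s : Finset ι) : v (∏ i ∈ s, f i) = ((∑ i ∈ s, n i : ℤ) : WithTop ℤ) := by
  classical
  induction s using Finset.induction_on with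
  | empty => simp
  | insert i s hi ih =>
    rw [Finset.prod_insert hi, Finset.sum_insert hi, v.map_mul, h, ih, WithTop.coe_add]

theorem map_monomialHom_eq {ι κ : Type*} [Fintype ι] (B : Matrix κ ι ℤ) {y : ι → Fˣ} {n : ι → ℤ}
    (h : ∀ i, v (y i : F) = n i) (j : κ) :
    v (monomialHom B y j : Fˣ) = ((∑ i, B j i * n i : ℤ) : WithTop ℤ) := by
  rw [monomialHom_apply, Units.coe_prod]
  refine v.map_prod_eq (fun i => ?_) _
  rw [Units.val_zpow_eq_zpow_val]
  exact TorusSystem.map_zpow_eq v (h i) _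

theorem eq_zero_of_mem_principalUnits {x : Fˣ} (hx : x ∈ v.principalUnits) : v (x : F) = 0 := by
  rw [v.map_eq_of_lt_sub (x := (1 : F)) (by rw [v.map_one]; exact hx), v.map_one]

end AddValuation

theorem monomialHom_mul_zpow {ι κ G : Type*} [Fintype ι] [CommGroup G] (B : Matrix κ ι ℤ)
    (y : ι → G) (t : G) (a : ι → ℤ) (j : κ) :
    monomialHom B (fun ν => y ν * t ^ a ν) j = monomialHom B y j * t ^ (∑ ν, B j ν * a ν) := by
  simp only [monomialHom_apply, mul_zpow, Finset.prod_mul_distrib, ← zpow_mul]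
  rw [zpow_finset_sum]
  congr 1
  exact Finset.prod_congr rfl fun ν _ => by rw [mul_comm]

namespace IdealTriangulation

variable {m : ℕ} {K : IdealTriangulation (m + 1)} {E : Fin (m + 1) ≃ K.Edge}
  {I : Fin (m + 1) → Degeneration}

variable (I) in
/-- The coordinates vanishing at the degeneration. -/
def uCoord {F : Type*} [Field F] (x : Coord (m + 1) → F) (ν : Fin (m + 1)) : F :=
  Degeneration.uOf (x (zIdx ν)) (x (wIdx ν)) (I ν)

/-- The uniformizing coordinate at the degeneration. -/
def Weights.tauCoord (W : K.Weights E I) {F : Type*} [Field F] (x : Coord (m + 1) → F) : F :=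
  ∏ ν, uCoord I x ν ^ W.l ν

/-- The coordinates which are units at the degeneration. -/
def Weights.yCoord (W : K.Weights E I) {F : Type*} [Field F] (x : Coord (m + 1) → F)
    (ν : Fin (m + 1)) : F :=
  uCoord I x ν * (W.tauCoord x ^ W.a ν)⁻¹

theorem map_uCoord {F F' : Type*} [Field F] [Field F'] (f : F →+* F') (x : Coord (m + 1) → F)
    (ν : Fin (m + 1)) : f (uCoord I x ν) = uCoord I (fun i => f (x i)) ν := by
  unfold uCoord
  cases I ν <;> simp [Degeneration.uOf]

theorem Weights.map_tauCoord (W : K.Weights E I) {F F' : Type*} [Field F] [Field F']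
    (f : F →+* F') (x : Coord (m + 1) → F) :
    f (W.tauCoord x) = W.tauCoord (fun i => f (x i)) := by
  simp only [Weights.tauCoord, map_prod, map_zpow₀, map_uCoord]

theorem Weights.map_yCoord (W : K.Weights E I) {F F' : Type*} [Field F] [Field F']
    (f : F →+* F') (x : Coord (m + 1) → F) (ν : Fin (m + 1)) :
    f (W.yCoord x ν) = W.yCoord (fun i => f (x i)) ν := by
  simp only [Weights.yCoord, map_mul, map_inv₀, map_pow, map_uCoord, Weights.map_tauCoord]

theorem IsDeformation.uCoord_ne_zero {F : Type*} [Field F] {x : Coord (m + 1) → F}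
    (h : IsDeformation K E x) (ν : Fin (m + 1)) : uCoord I x ν ≠ 0 := by
  have h1 := h.z_ne_zero ν
  have h2 := h.w_ne_zero ν
  unfold uCoord
  cases I ν <;> simpa [Degeneration.uOf]

theorem IsDeformation.one_sub_uCoord_ne_zero {F : Type*} [Field F] {x : Coord (m + 1) → F}
    (h : IsDeformation K E x) (ν : Fin (m + 1)) : 1 - uCoord I x ν ≠ 0 := by
  have h1 := h.z_ne_zero ν
  have h2 := h.w_ne_zero ν
  have h3 := h.add ν
  unfold uCoord
  cases I ν <;> simp only [Degeneration.uOf]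
  · rwa [← h3, add_sub_cancel_right]
  · rwa [← h3, add_sub_cancel_left]
  · intro h0
    apply h2
    have h4 : x (zIdx ν) = 1 := by
      rw [sub_eq_zero] at h0
      rw [← inv_inv (x (zIdx ν)), ← h0, inv_one]
    rw [h4] at h3
    simpa using h3

/-- A point of the deformation variety is determined by the coordinates vanishing at the
degeneration. -/
theorem IsDeformation.ext {F : Type*} [Field F] {x x' : Coord (m + 1) → F}
    (h : IsDeformation K E x) (h' : IsDeformation K E x')
    (hu : ∀ ν, uCoord I x ν = uCoord I x' ν) : x = x' := by
  have key : ∀ ν, x (zIdx ν) = x' (zIdx ν) ∧ x (wIdx ν) = x' (wIdx ν) := by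
    intro ν
    let u := Units.mk0 _ (h.uCoord_ne_zero (I := I) ν)
    let s := Units.mk0 _ (h.one_sub_uCoord_ne_zero (I := I) ν)
    have hs : (s : F) = 1 - u := rfl
    have hu1 : (u : F) = Degeneration.uOf (x (zIdx ν)) (x (wIdx ν)) (I ν) := rfl
    have hu2 : (u : F) = Degeneration.uOf (x' (zIdx ν)) (x' (wIdx ν)) (I ν) := hu ν
    exact ⟨(Degeneration.zOf_uOf (h.add ν) hu1 hs).symm.trans
      (Degeneration.zOf_uOf (h'.add ν) hu2 hs),
      (Degeneration.wOf_uOf (h.add ν) hu1 hs).symm.trans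
      (Degeneration.wOf_uOf (h'.add ν) hu2 hs)⟩
  ext i
  rcases i with ν | ν | ⟨⟨⟩⟩
  · exact (key ν).1
  · exact (key ν).2
  · have h1 := h.mul
    rw [← h'.mul] at h1
    simp only [(key _).1, (key _).2] at h1
    refine mul_left_cancel₀ (fun h0 => ?_) h1
    have := h'.mul
    rw [h0, zero_mul] at this
    exact zero_ne_one this

theorem isDeformation_iff_monomial {F : Type*} [Field F] [Algebra ℂ F] (W : K.Weights E I)
    {x : Coord (m + 1) → F} {u s : Fin (m + 1) → Fˣ} (hs : ∀ ν, (s ν : F) = 1 - u ν)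
    (hz : ∀ ν, (Degeneration.zOf (u ν) (s ν) (I ν) : Fˣ) = x (zIdx ν))
    (hw : ∀ ν, (Degeneration.wOf (u ν) (s ν) (I ν) : Fˣ) = x (wIdx ν))
    (ht : (∏ ν, x (zIdx ν)) * (∏ ν, x (wIdx ν)) * x tIdx = 1) :
    IsDeformation K E x ↔ ∀ j : Fin m,
      monomialHom W.system.B u j.succ * monomialHom W.system.S s j.succ =
        Units.map (algebraMap ℂ F).toMonoidHom (W.system.ε j.succ) := by
  have key : ∀ j : Fin m, _ ↔ _ := fun j => (prod_gluing_eq_one_iff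
    (z := fun ν => x (zIdx ν)) (w := fun ν => x (wIdx ν))
    (fun ν => K.p (E j.castSucc) ν) (fun ν => K.p' (E j.castSucc) ν)
    (fun ν => K.p'' (E j.castSucc) ν) (fun ν => hz ν ▸ Units.ne_zero _)
    (fun ν => hw ν ▸ Units.ne_zero _))
  have hadd : ∀ ν, x (zIdx ν) + x (wIdx ν) = 1 := fun ν => by
    rw [← hz, ← hw]
    exact Degeneration.zOf_add_wOf (hs ν) (I ν)
  have key2 : ∀ j : Fin m, monomialHom W.system.B u j.succ * monomialHom W.system.S s j.succ =
        Units.map (algebraMap ℂ F).toMonoidHom (W.system.ε j.succ) ↔ _ := fun j =>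
    (prod_gluing_factor_eq_one_iff W u s j).symm.trans (Iff.trans ?_ (key j))
  · simp only [key2]
    exact ⟨fun h => h.glue, fun h => ⟨h, hadd, ht⟩⟩
  · rw [← Units.val_inj]
    simp only [Units.coe_prod, Units.val_mul, Units.val_pow_eq_pow_val, Units.val_neg,
      Units.val_inv_eq_inv_val, Units.val_one, hz, hw]

/-- The vector `B a` has entry 1 in row 0 and 0 elsewhere. Passing from `u` to `y = u t ^ (-a)`
therefore changes only row 0, by the factor `t⁻¹`. -/
theorem Weights.isSolution_iff {F : Type*} [Field F] [Algebra ℂ F] (W : K.Weights E I)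
    {u s : Fin (m + 1) → Fˣ} {t : Fˣ} (hs : ∀ ν, (s ν : F) = 1 - u ν) :
    W.system.IsSolution (fun ν => u ν * (t ^ W.a ν)⁻¹) s (t : F) ↔
      ∏ ν, u ν ^ W.l ν = t ∧ ∀ j : Fin m,
        monomialHom W.system.B u j.succ * monomialHom W.system.S s j.succ =
          Units.map (algebraMap ℂ F).toMonoidHom (W.system.ε j.succ) := by
  have hy : (fun ν => u ν * (t ^ W.a ν)⁻¹) = fun ν => u ν * t ^ (-(W.a ν : ℤ)) := by
    ext ν
    rw [zpow_neg, zpow_natCast]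
  have h0 : ∑ ν, W.system.B 0 ν * -(W.a ν : ℤ) = -1 := by
    simp only [mul_neg, Finset.sum_neg_distrib]
    rw [← W.sum_l]
    rfl
  have hj : ∀ j : Fin m, ∑ ν, W.system.B j.succ ν * -(W.a ν : ℤ) = 0 := fun j => by
    simp only [mul_neg, Finset.sum_neg_distrib]
    rw [neg_eq_zero, ← W.sum_R j]
    rfl
  have e0 : W.system.ε 0 = 1 := rfl
  have s0 : monomialHom W.system.S s 0 = 1 := by
    rw [monomialHom_apply]
    exact Finset.prod_eq_one fun ν _ => zpow_zero (s ν)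
  have b0 : monomialHom W.system.B u 0 = ∏ ν, u ν ^ W.l ν := rfl
  have hsa : W.system.a = W.a := rfl
  rw [hy]
  constructor
  · intro h
    refine ⟨?_, fun j => ?_⟩
    · have := h.eqn 0
      rw [monomialHom_mul_zpow, h0, e0, s0, b0, map_one, mul_one, zpow_neg_one,
        mul_inv_eq_one] at this
      exact this
    · have := h.eqn j.succ
      rwa [monomialHom_mul_zpow, hj, zpow_zero, mul_one] at this
  · rintro ⟨h1, h2⟩
    refine ⟨fun ν => ?_, fun j => ?_⟩
    · rw [hs, hsa]
      simp
    · refine Fin.cases ?_ (fun j => ?_) j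
      · rw [monomialHom_mul_zpow, h0, e0, s0, b0, map_one, mul_one, zpow_neg_one,
          mul_inv_eq_one]
        exact h1
      · rw [monomialHom_mul_zpow, hj, zpow_zero, mul_one]
        exact h2 j

/-! ### The generic point of a branch -/

section BranchPoint

open TorusSystem

variable {W : K.Weights E I} (c : W.system.Center)

theorem exists_branchUnits : ∃ (u s : Fin (m + 1) → (BranchField c)ˣ) (t : (BranchField c)ˣ),
    (t : BranchField c) = toBranchField c (W.system.solutionBranch c.1).τ ∧
    (∀ ν, (u ν : BranchField c) = toBranchField c ((W.system.solutionBranch c.1).y ν) *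
      toBranchField c (W.system.solutionBranch c.1).τ ^ W.a ν) ∧
    (∀ ν, (s ν : BranchField c) = 1 - u ν) ∧ ∏ ν, u ν ^ W.l ν = t ∧ ∀ j : Fin m,
      monomialHom W.system.B u j.succ * monomialHom W.system.S s j.succ =
        Units.map (algebraMap ℂ (BranchField c)).toMonoidHom (W.system.ε j.succ) := by
  set b := W.system.solutionBranch c.1
  have hτ : toBranchField c b.τ ≠ 0 :=
    (map_ne_zero_iff _ (toBranchField_injective c)).mpr (irreducible_tau c).ne_zero
  have hsol := b.isSolution.map (toBranchField c)
  let t := Units.mk0 _ hτ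
  let u := fun ν => Units.map (toBranchField c).toMonoidHom (b.y ν) * t ^ W.a ν
  let s := fun ν => Units.map (toBranchField c).toMonoidHom (b.w ν)
  have hs : ∀ ν, (s ν : BranchField c) = 1 - u ν := hsol.w_eq
  have hy : (fun ν => u ν * (t ^ W.a ν)⁻¹) =
      fun ν => Units.map (toBranchField c).toMonoidHom (b.y ν) := by
    ext1 ν
    rw [mul_inv_cancel_right]
  rw [← hy] at hsol
  obtain ⟨h1, h2⟩ := (W.isSolution_iff (t := t) hs).mp hsol
  exact ⟨u, s, t, rfl, fun ν => rfl, hs, h1, h2⟩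

theorem exists_branchPoint : ∃ x : Coord (m + 1) → BranchField c, IsDeformation K E x ∧
    (∀ ν, uCoord I x ν = toBranchField c ((W.system.solutionBranch c.1).y ν) *
      toBranchField c (W.system.solutionBranch c.1).τ ^ W.a ν) ∧
    W.tauCoord x = toBranchField c (W.system.solutionBranch c.1).τ := by
  obtain ⟨u, s, t, ht, hu, hs, hl, hR⟩ := exists_branchUnits c
  let z := fun ν => ((Degeneration.zOf (u ν) (s ν) (I ν) : (BranchField c)ˣ) : BranchField c)
  let w := fun ν => ((Degeneration.wOf (u ν) (s ν) (I ν) : (BranchField c)ˣ) : BranchField c)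
  let x : Coord (m + 1) → BranchField c :=
    Sum.elim z (Sum.elim w fun _ => ((∏ ν, z ν) * ∏ ν, w ν)⁻¹)
  have hzw : (∏ ν, z ν) * ∏ ν, w ν ≠ 0 :=
    mul_ne_zero (Finset.prod_ne_zero_iff.mpr fun ν _ => Units.ne_zero _)
      (Finset.prod_ne_zero_iff.mpr fun ν _ => Units.ne_zero _)
  have hux : ∀ ν, uCoord I x ν = u ν := fun ν => Degeneration.uOf_zOf_wOf (u ν) (s ν) (I ν)
  refine ⟨x, (isDeformation_iff_monomial W hs (fun ν => rfl) (fun ν => rfl)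
    (mul_inv_cancel₀ hzw)).mpr hR, fun ν => by rw [hux, hu], ?_⟩
  rw [Weights.tauCoord, ← ht, ← hl, Units.coe_prod]
  simp only [hux, Units.val_zpow_eq_zpow_val]

/-- The generic point of the branch, as a point of the deformation variety. -/
def branchPoint : Coord (m + 1) → BranchField c := (exists_branchPoint c).choose

theorem isDeformation_branchPoint : IsDeformation K E (branchPoint c) :=
  (exists_branchPoint c).choose_spec.1

theorem uCoord_branchPoint (ν : Fin (m + 1)) : uCoord I (branchPoint c) ν =
    toBranchField c ((W.system.solutionBranch c.1).y ν) *
      toBranchField c (W.system.solutionBranch c.1).τ ^ W.a ν :=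
  (exists_branchPoint c).choose_spec.2.1 ν

theorem tauCoord_branchPoint :
    W.tauCoord (branchPoint c) = toBranchField c (W.system.solutionBranch c.1).τ :=
  (exists_branchPoint c).choose_spec.2.2

theorem yCoord_branchPoint (ν : Fin (m + 1)) :
    W.yCoord (branchPoint c) ν = toBranchField c ((W.system.solutionBranch c.1).y ν) := by
  have hτ : toBranchField c (W.system.solutionBranch c.1).τ ≠ 0 :=
    (map_ne_zero_iff _ (toBranchField_injective c)).mpr (irreducible_tau c).ne_zero
  rw [Weights.yCoord, uCoord_branchPoint, tauCoord_branchPoint,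
    mul_inv_cancel_right₀ (pow_ne_zero _ hτ)]

theorem branchVal_uCoord_pos (ν : Fin (m + 1)) : 0 < branchVal c (uCoord I (branchPoint c) ν) := by
  rw [uCoord_branchPoint, AddValuation.map_mul, branchVal_unit, zero_add, AddValuation.map_pow,
    branchVal_tau]
  exact nsmul_pos one_pos (W.a_pos ν).ne'

/-- The center is recovered as the reduction of the functions `y ν`, which separates distinct
branches. -/
theorem branchVal_yCoord_sub_pos (ν : Fin (m + 1)) :
    0 < branchVal c (W.yCoord (branchPoint c) ν - algebraMap ℂ _ (c.1 ν : ℂ)) := by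
  have h1 : ((W.system.solutionBranch c.1).y ν : W.system.SolutionRing c.1) -
      algebraMap ℂ _ (c.1 ν : ℂ) ∈ IsLocalRing.maximalIdeal (W.system.SolutionRing c.1) := by
    rw [mem_maximalIdeal_iff, map_sub, AlgHom.commutes, evaluation_y]
    exact sub_self _
  rw [maximalIdeal_eq_span, Ideal.mem_span_singleton'] at h1
  obtain ⟨r, hr⟩ := h1
  have h2 := congrArg (fun x => branchVal c (toBranchField c x)) hr
  rw [yCoord_branchPoint, ← (toBranchField c).commutes, ← map_sub]
  change _ < branchVal c (toBranchField c _)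
  simp only [map_mul, AddValuation.map_mul, branchVal_tau] at h2
  rw [← h2]
  exact one_pos.trans_le (le_add_of_nonneg_left (branchVal_nonneg c r))

end BranchPoint

/-! ### Solutions over a valued field near a degeneration -/

/-- Taking values in the gluing equations removes the `1 - u ν` and the signs, so the vector `n` of
values of the `u ν` lies in the kernel of `R(I)`. Hence `n = k a` with `k = l · n = v(τ)`, positive
as `n` and `a` are. Then the `y ν` have value zero, and the results on solutions over a valued field
apply. -/
theorem IsDeformation.exists_branch_hom {F : Type} [Field F] [Algebra ℂ F] (W : K.Weights E I)
    {v : AddValuation F (WithTop ℤ)} (hv : ∀ z : ℂ, z ≠ 0 → v (algebraMap ℂ F z) = 0)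
    {x : Coord (m + 1) → F} (hx : IsDeformation K E x) (hu : ∀ ν, 0 < v (uCoord I x ν)) :
    ∃ (c : W.system.Center) (k : ℤ) (φ : TorusSystem.BranchField c →ₐ[ℂ] F), 0 < k ∧
      (∀ i, φ (branchPoint c i) = x i) ∧
      ∀ y ≠ 0, ∃ n : ℤ, TorusSystem.branchVal c y = n ∧ v (φ y) = ((n * k : ℤ) : WithTop ℤ) := by
  let u := fun ν => Units.mk0 _ (hx.uCoord_ne_zero (I := I) ν)
  let s := fun ν => Units.mk0 _ (hx.one_sub_uCoord_ne_zero (I := I) ν)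
  have hs : ∀ ν, (s ν : F) = 1 - u ν := fun ν => rfl
  have hglue := (isDeformation_iff_monomial W hs
    (fun ν => Degeneration.zOf_uOf (hx.add ν) rfl (hs ν))
    (fun ν => Degeneration.wOf_uOf (hx.add ν) rfl (hs ν)) hx.mul).mp hx
  have hsmem : ∀ ν, s ν ∈ v.principalUnits := fun ν => by
    rw [AddValuation.mem_principalUnits, hs, sub_sub_cancel_left, v.map_neg]
    exact hu ν
  choose n hn using fun ν => v.exists_eq_coe (u ν).ne_zero
  have hker : ∀ j : Fin m, ∑ ν, W.system.B j.succ ν * n ν = 0 := by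
    intro j
    have h1 := congrArg (fun y : Fˣ => v (y : F)) (hglue j)
    simp only [Units.val_mul, v.map_mul] at h1
    rw [v.map_monomialHom_eq _ hn, v.eq_zero_of_mem_principalUnits
      (v.monomialHom_mem_principalUnits _ hsmem _), add_zero] at h1
    have h2 : v ((Units.map (algebraMap ℂ F).toMonoidHom (W.system.ε j.succ) : Fˣ) : F) = 0 :=
      hv _ (Units.ne_zero _)
    rw [h2] at h1
    exact_mod_cast h1
  set k := ∑ ν, W.l ν * n ν with hk
  have hna : ∀ ν, n ν = k * W.a ν := by
    -- The difference is killed by row 0 by the choice of `k` and by the other rows because both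
    -- vectors lie in the kernel of `R(I)`; and `B` is nonsingular.
    have h0 : (fun ν => n ν - k * W.a ν) = 0 := by
      refine Matrix.eq_zero_of_mulVec_eq_zero W.system.det_ne ?_
      ext j
      have hexp : (W.system.B.mulVec fun ν => n ν - k * W.a ν) j =
          ∑ ν, W.system.B j ν * n ν - k * ∑ ν, W.system.B j ν * W.a ν := by
        simp only [Matrix.mulVec, dotProduct]
        rw [Finset.mul_sum, ← Finset.sum_sub_distrib]
        exact Finset.sum_congr rfl fun ν _ => by ring
      rw [hexp]
      refine Fin.cases ?_ (fun j => ?_) j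
      · have h1 : ∑ ν, W.system.B 0 ν * (W.a ν : ℤ) = 1 := W.sum_l
        have h2 : ∑ ν, W.system.B 0 ν * n ν = k := rfl
        rw [h1, h2]
        simp
      · have h1 : ∑ ν, W.system.B j.succ ν * (W.a ν : ℤ) = 0 := W.sum_R j
        rw [h1, hker]
        simp
    exact fun ν => sub_eq_zero.mp (congrFun h0 ν)
  let t := ∏ ν, u ν ^ W.l ν
  have hvt : v (t : F) = k := by
    have := v.map_monomialHom_eq W.system.B hn 0
    exact this
  have hk0 : 0 < k := by
    have h1 : 0 < v (u 0 : F) := hu 0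
    rw [hn, hna] at h1
    have h2 : (0 : ℤ) < k * W.a 0 := by exact_mod_cast h1
    exact pos_of_mul_pos_left h2 (by positivity)
  have hsol := (W.isSolution_iff (t := t) hs).mpr ⟨rfl, hglue⟩
  have hvy : ∀ ν, v ((u ν * (t ^ W.a ν)⁻¹ : Fˣ) : F) = 0 := by
    intro ν
    have h1 : v (((t ^ W.a ν)⁻¹ : Fˣ) : F) = ((-(k * W.a ν) : ℤ) : WithTop ℤ) := by
      have := TorusSystem.map_zpow_eq v hvt (-(W.a ν : ℤ))
      rw [zpow_neg, zpow_natCast] at this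
      rw [Units.val_inv_eq_inv_val, Units.val_pow_eq_pow_val, this, neg_mul, mul_comm]
    rw [Units.val_mul, v.map_mul, hn, h1, hna, ← WithTop.coe_add, add_neg_cancel]
    rfl
  have hvt0 : 0 < v (t : F) := by
    rw [hvt]
    exact_mod_cast hk0
  obtain ⟨c, hc⟩ := hsol.exists_center hv hvt0 hvy
  obtain ⟨φ, hφτ, hφy, hφ⟩ := hsol.exists_branch_hom hv hk0 hvt c hc
  refine ⟨c, k, φ, hk0, ?_, hφ⟩
  -- The image of the generic point and `x` both satisfy the equations and have the same
  -- `u`-coordinates, so they coincide.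
  have hdef : IsDeformation K E (fun i => φ (branchPoint c i)) := by
    rw [isDeformation_iff]
    intro q hq
    have h1 := (isDeformation_iff _).mp (isDeformation_branchPoint c) q hq
    have h2 : MvPolynomial.aeval (fun i => φ (branchPoint c i)) q =
        φ (MvPolynomial.aeval (branchPoint c) q) := by
      rw [← AlgHom.comp_apply, MvPolynomial.comp_aeval]
    rw [h2, h1, map_zero]
  refine fun i => congrFun (hdef.ext (I := I) hx fun ν => ?_) i
  have := map_uCoord (I := I) φ.toRingHom (branchPoint c) ν
  refine this.symm.trans ?_
  change φ (uCoord I (branchPoint c) ν) = u ν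
  rw [uCoord_branchPoint, map_mul, map_pow, hφτ, hφy, Units.val_mul, Units.val_inv_eq_inv_val,
    Units.val_pow_eq_pow_val, inv_mul_cancel_right₀ (pow_ne_zero _ t.ne_zero)]

end IdealTriangulation

end

/-! ### Ideal points correspond to centers -/

noncomputable section

namespace AffineSet

variable {σ : Type} {Y : Set (σ → ℂ)}

theorem algebraMap_mk_eq_aeval (q : MvPolynomial σ ℂ) :
    algebraMap (CoordRing Y) (FunctionField Y) (Ideal.Quotient.mk _ q) =
      MvPolynomial.aeval (coordFun Y) q := by
  have : (IsScalarTower.toAlgHom ℂ (CoordRing Y) (FunctionField Y)).comp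
      (Ideal.Quotient.mkₐ ℂ (MvPolynomial.vanishingIdeal ℂ Y)) =
      MvPolynomial.aeval (coordFun Y) := by
    apply MvPolynomial.algHom_ext
    intro i
    rw [MvPolynomial.aeval_X]
    rfl
  exact DFunLike.congr_fun this q

theorem aeval_coordFun_eq_zero_iff (q : MvPolynomial σ ℂ) :
    MvPolynomial.aeval (coordFun Y) q = 0 ↔ q ∈ MvPolynomial.vanishingIdeal ℂ Y := by
  rw [← algebraMap_mk_eq_aeval, ← Ideal.Quotient.eq_zero_iff_mem,
    map_eq_zero_iff _ (IsFractionRing.injective (CoordRing Y) (FunctionField Y))]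

theorem IsIrreducibleCurve.isDomain (h : IsIrreducibleCurve Y) : IsDomain (CoordRing Y) :=
  have := h.irreducible
  Ideal.Quotient.isDomain _

/-- Homomorphisms of function fields which agree on the coordinate functions are equal. -/
theorem functionField_hom_ext {R : Type*} [CommRing R] [Algebra ℂ R]
    {f g : FunctionField Y →ₐ[ℂ] R} (h : ∀ i, f (coordFun Y i) = g (coordFun Y i)) : f = g := by
  refine IsLocalization.algHom_ext (nonZeroDivisors (CoordRing Y)) ?_
  refine Ideal.Quotient.algHom_ext _ (MvPolynomial.algHom_ext fun i => h i)

end AffineSet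

namespace IdealTriangulation

open AffineSet TorusSystem

variable {m : ℕ} {K : IdealTriangulation (m + 1)} {E : Fin (m + 1) ≃ K.Edge}
  {I : Fin (m + 1) → Degeneration} {W : K.Weights E I}

/-- The ideal point `P` is the branch through the center `c`. -/
def IsBranch (P : IdealPoint (K.deformationVariety E)) (c : W.system.Center) : Prop :=
  ∃ Φ : FunctionField P.curve →ₐ[ℂ] BranchField c,
    (∀ i, Φ (coordFun P.curve i) = branchPoint c i) ∧ ∀ x, P.val x = branchVal c (Φ x)

theorem isDeformation_coordFun (P : IdealPoint (K.deformationVariety E))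
    [IsDomain (CoordRing P.curve)] : IsDeformation K E (coordFun P.curve) := by
  rw [isDeformation_iff]
  intro q hq
  rw [aeval_coordFun_eq_zero_iff]
  intro x hx
  exact (isDeformation_iff x).mp ((mem_deformationVariety_iff x).mp (P.curve_subset hx)) q hq

theorem correspondsTo_iff (P : IdealPoint (K.deformationVariety E))
    [IsDomain (CoordRing P.curve)] :
    P.CorrespondsTo I ↔ ∀ ν, 0 < P.val (uCoord I (coordFun P.curve) ν) := by
  refine forall_congr' fun ν => ?_
  have hz := (isDeformation_coordFun P).z_ne_zero ν
  unfold uCoord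
  cases I ν
  · rfl
  · rfl
  · obtain ⟨n, hn⟩ := P.val.exists_eq_coe hz
    change P.val (coordFun P.curve (zIdx ν)) < 0 ↔ 0 < P.val (coordFun P.curve (zIdx ν))⁻¹
    rw [P.val.map_inv, hn]
    change (n : WithTop ℤ) < ((0 : ℤ) : WithTop ℤ) ↔ ((0 : ℤ) : WithTop ℤ) < ((-n : ℤ) : WithTop ℤ)
    rw [WithTop.coe_lt_coe, WithTop.coe_lt_coe]
    omega

/-- The coordinate functions generate `ℂ(Y)` and lie in the image of the branch field, so `φ` is an
isomorphism. It multiplies values by `k`, and since the value 1 is attained on `ℂ(Y)`, `k = 1`. -/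
theorem exists_isBranch (W : K.Weights E I) (P : IdealPoint (K.deformationVariety E))
    (hP : P.CorrespondsTo I) : ∃ c : W.system.Center, IsBranch P c := by
  have := P.isIrreducibleCurve.isDomain
  obtain ⟨c, k, φ, hk, hφ, hval⟩ := (isDeformation_coordFun P).exists_branch_hom W (v := P.val)
    P.val_const ((correspondsTo_iff P).mp hP)
  have haeval : ∀ q, φ (MvPolynomial.aeval (branchPoint c) q) =
      MvPolynomial.aeval (coordFun P.curve) q := fun q => by
    rw [← AlgHom.comp_apply, MvPolynomial.comp_aeval]
    congr 2
    exact funext hφ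
  have hsurj : Function.Surjective φ := by
    intro x
    obtain ⟨a, b, -, rfl⟩ := IsFractionRing.div_surjective (A := CoordRing P.curve) x
    obtain ⟨f, rfl⟩ := Ideal.Quotient.mk_surjective a
    obtain ⟨g, rfl⟩ := Ideal.Quotient.mk_surjective b
    refine ⟨MvPolynomial.aeval (branchPoint c) f / MvPolynomial.aeval (branchPoint c) g, ?_⟩
    rw [map_div₀, haeval, haeval, algebraMap_mk_eq_aeval, algebraMap_mk_eq_aeval]
  let e := AlgEquiv.ofBijective φ ⟨φ.toRingHom.injective, hsurj⟩
  have hφe : ∀ x, φ (e.symm x) = x := fun x => e.apply_symm_apply x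
  have hk1 : k = 1 := by
    obtain ⟨x, hx⟩ := P.val_normalized
    have hx0 : e.symm x ≠ 0 := by
      rw [ne_eq, EmbeddingLike.map_eq_zero_iff]
      rintro rfl
      simp at hx
    obtain ⟨n, -, hn⟩ := hval _ hx0
    rw [hφe, hx] at hn
    have h1 : (1 : ℤ) = n * k := by exact_mod_cast hn
    exact Int.eq_one_of_dvd_one hk.le (Dvd.intro_left n h1.symm)
  refine ⟨c, e.symm.toAlgHom, fun i => ?_, fun x => ?_⟩
  · change e.symm (coordFun P.curve i) = _
    rw [AlgEquiv.symm_apply_eq]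
    exact (hφ i).symm
  · change P.val x = branchVal c (e.symm x)
    by_cases hx : x = 0
    · rw [hx, P.val.map_zero, _root_.map_zero e.symm, (branchVal c).map_zero]
    · obtain ⟨n, hn, hn'⟩ := hval (e.symm x) (by simpa using hx)
      rw [hn, ← hφe x, hn', hk1, mul_one]

theorem IsBranch.aeval_eq {P : IdealPoint (K.deformationVariety E)} {c : W.system.Center}
    {Φ : FunctionField P.curve →ₐ[ℂ] BranchField c}
    (h : ∀ i, Φ (coordFun P.curve i) = branchPoint c i) (q : MvPolynomial (Coord (m + 1)) ℂ) :
    Φ (MvPolynomial.aeval (coordFun P.curve) q) = MvPolynomial.aeval (branchPoint c) q := by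
  rw [← AlgHom.comp_apply, MvPolynomial.comp_aeval]
  congr 2
  exact funext h

theorem IsBranch.mem_vanishingIdeal_iff {P : IdealPoint (K.deformationVariety E)}
    {c : W.system.Center} (h : IsBranch P c) (q : MvPolynomial (Coord (m + 1)) ℂ) :
    q ∈ MvPolynomial.vanishingIdeal ℂ P.curve ↔ MvPolynomial.aeval (branchPoint c) q = 0 := by
  have := P.isIrreducibleCurve.isDomain
  obtain ⟨Φ, hΦ, -⟩ := h
  rw [← aeval_coordFun_eq_zero_iff, ← IsBranch.aeval_eq hΦ,
    map_eq_zero_iff Φ Φ.toRingHom.injective]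

/-- The branch determines the curve, whose ideal consists of the relations between the coordinates
of the generic point. It also determines the embedding of function fields, and with it the
valuation. -/
theorem IsBranch.eq {P P' : IdealPoint (K.deformationVariety E)} {c : W.system.Center}
    (h : IsBranch P c) (h' : IsBranch P' c) : P = P' := by
  have hcurve : P.curve = P'.curve := by
    rw [← P.isIrreducibleCurve.closed, ← P'.isIrreducibleCurve.closed]
    congr 1
    ext q
    rw [h.mem_vanishingIdeal_iff, h'.mem_vanishingIdeal_iff]
  obtain ⟨Φ, hΦ, hv⟩ := h
  obtain ⟨Φ', hΦ', hv'⟩ := h'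
  obtain ⟨Y, hY, hirr, v, _, _, _⟩ := P
  obtain ⟨Y', hY', hirr', v', _, _, _⟩ := P'
  obtain rfl : Y = Y' := hcurve
  have hΦΦ : Φ = Φ' := functionField_hom_ext fun i => (hΦ i).trans (hΦ' i).symm
  obtain rfl : v = v' := AddValuation.ext fun x => by rw [hv, hv', hΦΦ]
  rfl

/-- If some `y ν` reduced to two different constants, their difference would be a nonzero constant
of positive value. -/
theorem IsBranch.center_eq {P : IdealPoint (K.deformationVariety E)} {c c' : W.system.Center}
    (h : IsBranch P c) (h' : IsBranch P c') : c = c' := by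
  have := P.isIrreducibleCurve.isDomain
  have key : ∀ (c : W.system.Center), IsBranch P c → ∀ ν, 0 < P.val (W.yCoord (coordFun P.curve) ν -
      algebraMap ℂ _ ((c.1 ν : ℂˣ) : ℂ)) := by
    rintro c ⟨Φ, hΦ, hv⟩ ν
    have h1 : Φ (W.yCoord (coordFun P.curve) ν) = W.yCoord (branchPoint c) ν := by
      refine (W.map_yCoord Φ.toRingHom (coordFun P.curve) ν).trans ?_
      congr 1
      exact funext hΦ
    rw [hv, map_sub, AlgHom.commutes, h1]
    exact branchVal_yCoord_sub_pos c ν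
  refine Subtype.ext (funext fun ν => Units.ext ?_)
  by_contra hne
  have h1 := P.val.map_lt_add (key c' h' ν) (by
    rw [P.val.map_neg]; exact key c h ν : 0 < P.val (-(W.yCoord (coordFun P.curve) ν -
      algebraMap ℂ _ ((c.1 ν : ℂˣ) : ℂ))))
  have h2 : W.yCoord (coordFun P.curve) ν - algebraMap ℂ _ ((c'.1 ν : ℂˣ) : ℂ) +
      -(W.yCoord (coordFun P.curve) ν - algebraMap ℂ _ ((c.1 ν : ℂˣ) : ℂ)) =
      algebraMap ℂ (FunctionField P.curve) ((c.1 ν : ℂ) - c'.1 ν) := by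
    rw [map_sub]
    ring
  rw [h2, P.val_const _ (sub_ne_zero.mpr hne)] at h1
  exact lt_irrefl _ h1

/-- The curve traced by a branch. -/
def branchCurve (c : W.system.Center) : Set (Coord (m + 1) → ℂ) :=
  MvPolynomial.zeroLocus ℂ (RingHom.ker (MvPolynomial.aeval (R := ℂ) (branchPoint c)))

/-- The Nullstellensatz for the kernel, which is prime because the target is a field. -/
theorem vanishingIdeal_branchCurve (c : W.system.Center) :
    MvPolynomial.vanishingIdeal ℂ (branchCurve c) =
      RingHom.ker (MvPolynomial.aeval (R := ℂ) (branchPoint c)) := by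
  have : (RingHom.ker (MvPolynomial.aeval (R := ℂ) (branchPoint c))).IsPrime :=
    RingHom.ker_isPrime _
  exact MvPolynomial.IsPrime.vanishingIdeal_zeroLocus _

theorem exists_functionField_hom (c : W.system.Center) :
    ∃ Φ : FunctionField (branchCurve c) →ₐ[ℂ] BranchField c, Function.Injective Φ ∧
      ∀ i, Φ (coordFun (branchCurve c) i) = branchPoint c i := by
  let f : CoordRing (branchCurve c) →ₐ[ℂ] BranchField c :=
    Ideal.Quotient.liftₐ _ (MvPolynomial.aeval (branchPoint c)) fun q hq => by
      rw [vanishingIdeal_branchCurve] at hq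
      exact hq
  have hf : Function.Injective f := by
    rw [injective_iff_map_eq_zero]
    intro x hx
    obtain ⟨q, rfl⟩ := Ideal.Quotient.mk_surjective x
    rw [Ideal.Quotient.eq_zero_iff_mem, vanishingIdeal_branchCurve]
    exact hx
  have hprime : (MvPolynomial.vanishingIdeal ℂ (branchCurve c)).IsPrime := by
    rw [vanishingIdeal_branchCurve]
    exact RingHom.ker_isPrime _
  have : IsDomain (CoordRing (branchCurve c)) := Ideal.Quotient.isDomain _
  let Φ : FunctionField (branchCurve c) →ₐ[ℂ] BranchField c := IsFractionRing.liftAlgHom hf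
  refine ⟨Φ, Φ.toRingHom.injective, fun i => ?_⟩
  refine (IsFractionRing.lift_algebraMap hf _).trans ?_
  exact MvPolynomial.aeval_X _ i

theorem branchCurve_subset (c : W.system.Center) :
    branchCurve c ⊆ K.deformationVariety E := by
  intro x hx
  rw [mem_deformationVariety_iff, isDeformation_iff]
  intro q hq
  exact hx q ((isDeformation_iff _).mp (isDeformation_branchPoint c) q hq)

theorem isDomain_coordRing_branchCurve (c : W.system.Center) :
    IsDomain (CoordRing (branchCurve c)) := by
  have : (MvPolynomial.vanishingIdeal ℂ (branchCurve c)).IsPrime := by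
    rw [vanishingIdeal_branchCurve]
    exact RingHom.ker_isPrime _
  exact Ideal.Quotient.isDomain _

theorem tauCoord_val (c : W.system.Center) [IsDomain (CoordRing (branchCurve c))]
    (Φ : FunctionField (branchCurve c) →ₐ[ℂ] BranchField c)
    (hΦ : ∀ i, Φ (coordFun (branchCurve c) i) = branchPoint c i) :
    branchVal c (Φ (W.tauCoord (coordFun (branchCurve c)))) = 1 := by
  rw [← branchVal_tau c, ← tauCoord_branchPoint]
  congr 1
  refine (W.map_tauCoord Φ.toRingHom (coordFun (branchCurve c))).trans ?_
  congr 1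
  exact funext hΦ

/-- The dimension is at most one by embedding the function field in the branch field. It is not
zero: otherwise `τ` would be a constant, of value 0 or `⊤`, whereas its value is 1. -/
theorem isIrreducibleCurve_branchCurve (c : W.system.Center) :
    IsIrreducibleCurve (branchCurve c) where
  closed := by rw [vanishingIdeal_branchCurve]; rfl
  irreducible := by
    rw [vanishingIdeal_branchCurve]
    exact RingHom.ker_isPrime _
  dim_one := by
    have := isDomain_coordRing_branchCurve c
    obtain ⟨Φ, hinj, hΦ⟩ := exists_functionField_hom c
    refine le_antisymm ((trdeg_le_of_injective Φ hinj).trans (trdeg_branchField_le c)) ?_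
    rw [Cardinal.one_le_iff_pos]
    have : Algebra.Transcendental ℂ (FunctionField (branchCurve c)) := by
      rw [Algebra.transcendental_iff_not_isAlgebraic]
      intro halg
      obtain ⟨z, hz⟩ := IsAlgClosed.algebraMap_bijective_of_isIntegral
        (k := ℂ) (K := FunctionField (branchCurve c)) |>.2 (W.tauCoord (coordFun (branchCurve c)))
      have h1 := tauCoord_val c Φ hΦ
      rw [← hz, AlgHom.commutes] at h1
      by_cases hz0 : z = 0
      · rw [hz0, map_zero, AddValuation.map_zero] at h1
        exact absurd h1 (by decide)
      · rw [branchVal_const c z hz0] at h1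
        exact absurd h1 (by decide)
    exact trdeg_pos ℂ _

/-- The branch valuation is restricted to the function field of the curve; it stays normalized
because `τ` is a function of the coordinates. -/
theorem exists_idealPoint (c : W.system.Center) :
    ∃ P : IdealPoint (K.deformationVariety E), IsBranch P c ∧ P.CorrespondsTo I := by
  have := isDomain_coordRing_branchCurve c
  let Y := branchCurve c
  obtain ⟨Φ, hinj, hΦ⟩ : ∃ Φ : FunctionField Y →ₐ[ℂ] BranchField c, Function.Injective Φ ∧
      ∀ i, Φ (coordFun Y i) = branchPoint c i := exists_functionField_hom c
  let v : AddValuation (FunctionField Y) (WithTop ℤ) := (branchVal c).comap Φ.toRingHom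
  have hv : ∀ x, v x = branchVal c (Φ x) := fun x => rfl
  have hu : ∀ ν, 0 < v (uCoord I (coordFun Y) ν) := by
    intro ν
    have h1 : Φ (uCoord I (coordFun Y) ν) = uCoord I (branchPoint c) ν := by
      refine (map_uCoord Φ.toRingHom (coordFun Y) ν).trans ?_
      congr 1
      exact funext hΦ
    rw [hv, h1]
    exact branchVal_uCoord_pos c ν
  have hdef : IsDeformation K E (coordFun Y) := by
    rw [isDeformation_iff]
    intro q hq
    rw [aeval_coordFun_eq_zero_iff, vanishingIdeal_branchCurve]
    exact (isDeformation_iff _).mp (isDeformation_branchPoint c) q hq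
  have hconst : ∀ z : ℂ, z ≠ 0 → v (algebraMap ℂ (FunctionField Y) z) = 0 := fun z hz => by
    rw [hv, AlgHom.commutes, branchVal_const c z hz]
  -- Were all coordinates of nonnegative value, no `z ν` would have a pole, so `z_0` or `w_0` would
  -- have a zero. Then the product of all the `z ν`, all the `w ν` and `t` would have positive
  -- value, but it is 1.
  have hideal : ∃ i, v (coordFun Y i) < 0 := by
    by_contra! hnonneg
    have hprod : ∀ f : Fin (m + 1) → FunctionField Y, (∀ ν, 0 ≤ v (f ν)) →
        0 ≤ v (∏ ν, f ν) := by
      intro f hf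
      refine Finset.prod_induction f (fun x => 0 ≤ v x) (fun a b ha hb => ?_) ?_ fun ν _ => hf ν
      · rw [v.map_mul]
        exact add_nonneg ha hb
      · simp
    have hpos : 0 < v (coordFun Y (zIdx 0) * coordFun Y (wIdx 0)) := by
      rw [v.map_mul]
      have h0 := hu 0
      unfold uCoord at h0
      cases hI : I 0
      · rw [hI] at h0
        exact h0.trans_le (le_add_of_nonneg_left (hnonneg _))
      · rw [hI] at h0
        exact h0.trans_le (le_add_of_nonneg_right (hnonneg _))
      · rw [hI] at h0
        obtain ⟨n, hn⟩ := v.exists_eq_coe (hdef.z_ne_zero 0)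
        have h1 := hnonneg (zIdx 0)
        simp only [Degeneration.uOf] at h0
        rw [v.map_inv, hn] at h0
        rw [hn] at h1
        have h2 : (0 : ℤ) < -n := WithTop.coe_lt_coe.mp h0
        have h3 : (0 : ℤ) ≤ n := WithTop.coe_le_coe.mp h1
        omega
    have hmul := congrArg v hdef.mul
    rw [← Finset.prod_mul_distrib, Fin.prod_univ_succ, v.map_mul, v.map_mul, v.map_one] at hmul
    have hrest : 0 ≤ v (∏ ν : Fin m, coordFun Y (zIdx ν.succ) * coordFun Y (wIdx ν.succ)) := by
      refine Finset.prod_induction _ (fun x => 0 ≤ v x) (fun a b ha hb => ?_) ?_ fun ν _ => ?_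
      · rw [v.map_mul]
        exact add_nonneg ha hb
      · simp
      · rw [v.map_mul]
        exact add_nonneg (hnonneg _) (hnonneg _)
    have := (hpos.trans_le (le_add_of_nonneg_right hrest)).trans_le
      (le_add_of_nonneg_right (hnonneg tIdx))
    rw [hmul] at this
    exact lt_irrefl _ this
  let P : IdealPoint (K.deformationVariety E) :=
    { curve := Y
      curve_subset := branchCurve_subset c
      isIrreducibleCurve := isIrreducibleCurve_branchCurve c
      val := v
      val_const := hconst
      val_normalized := ⟨_, tauCoord_val c Φ hΦ⟩
      val_ideal := by
        obtain ⟨i, hi⟩ := hideal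
        exact ⟨_, hi⟩ }
  have : IsDomain (CoordRing P.curve) := ‹IsDomain (CoordRing Y)›
  exact ⟨P, ⟨Φ, hΦ, hv⟩, (correspondsTo_iff P).mpr hu⟩

theorem card_center (W : K.Weights E I) :
    Nat.card W.system.Center = W.system.B.det.natAbs :=
  card_monomialHom_fiber W.system.det_ne W.system.ε

/-- Ideal points corresponding to a degeneration are in bijection with centers of branches. -/
theorem encard_correspondsTo (W : K.Weights E I) :
    {P : IdealPoint (K.deformationVariety E) | P.CorrespondsTo I}.encard =
      (W.system.B.det.natAbs : ℕ∞) := by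
  choose P hP hI using fun c : W.system.Center => exists_idealPoint c
  have hbij : Function.Bijective (fun c => (⟨P c, hI c⟩ :
      {P : IdealPoint (K.deformationVariety E) | P.CorrespondsTo I})) := by
    constructor
    · intro c c' h
      have h1 : P c = P c' := congrArg Subtype.val h
      exact (hP c).center_eq (h1 ▸ hP c')
    · rintro ⟨Q, hQ⟩
      obtain ⟨c, hc⟩ := exists_isBranch W Q hQ
      exact ⟨c, Subtype.ext ((hP c).eq hc)⟩
  have hcard := card_center W
  have : Finite W.system.Center := Nat.finite_of_card_ne_zero (by
    rw [hcard]; exact Int.natAbs_ne_zero.mpr W.system.det_ne)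
  rw [← hcard, ← ENat.card_eq_coe_natCard, ENat.card_congr (Equiv.ofBijective _ hbij)]
  rfl

end IdealTriangulation

end

theorem theorem4p1 {m : ℕ} (K : IdealTriangulation (m + 1)) (E : Fin (m + 1) ≃ K.Edge)
    (I : Fin (m + 1) → Degeneration)
    (hd : (∀ ν, 0 < K.degenerationVector E I ν) ∨ (∀ ν, K.degenerationVector E I ν < 0)) :
    (∃ P : AffineSet.IdealPoint (K.deformationVariety E), P.CorrespondsTo I) ∧
      {P : AffineSet.IdealPoint (K.deformationVariety E) | P.CorrespondsTo I}.encard =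
        ((Finset.univ.gcd fun ν => (K.degenerationVector E I ν).natAbs : ℕ) : ℕ∞) := by
  obtain ⟨W, hW⟩ := IdealTriangulation.exists_weights K E I hd
  have hcard := IdealTriangulation.encard_correspondsTo W
  refine ⟨?_, hcard.trans (congrArg Nat.cast hW)⟩
  have hne : {P : AffineSet.IdealPoint (K.deformationVariety E) | P.CorrespondsTo I}.encard ≠ 0 := by
    rw [hcard]
    exact_mod_cast Int.natAbs_ne_zero.mpr W.system.det_ne
  exact Set.encard_ne_zero.mp hne
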